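/- **Setting.** Let $E,F,G$ be real Banach spaces. A path $X:[0,\infty)\to E$ is càdlàg if it is right continuous and has left limits $X_{t-}$ at all $t>0$; $\Delta X_t=X_t-X_{t-}$ for $t>0$, $\Delta X_0=0$. A càdlàg path $h$ has finite variation if it has bounded variation on every compact interval; then $h^{\mathrm c}_t=h_t-\sum_{0<s\le t}\Delta h_s$ is its continuous part. A partition $\pi$ of $[0,\infty)$ is a set of intervals $\{(t_i,t_{i+1}]: i\in\mathbb N\}$ with $0=t_0<t_1<\cdots\to\infty$; for $s>0$ let $(\underline{\pi}(s),\overline{\pi}(s)]$ be the interval of $\pi$ that contains $s$. For $I=(r,s]$ put $\delta X_t(I)=X_{s\wedge t}-X_{r\wedge t}$. Let $(\pi_n)_{n\in\mathbb N}$ be a sequence of partitions. * $(\pi_n)$ satisfies *Condition (C)* for a càdlàg path $Z$ if, with $D_\varepsilon(Z)=\{t:\|\Delta Z_t\|\ge\varepsilon\}$ and $J_\varepsilon(Z)_t=\sum_{0<s\le t,\,s\in D_\varepsilon(Z)}\Delta Z_s$: (C1) for all $t\ge 0$, $\varepsilon>0$ there is $N$ such that $I\cap[0,t]\cap D_\varepsilon(Z)$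 has at most one element for all $n\ge N$, $I\in\pi_n$; (C2) for all $s$ with $\Delta Z_s\ne0$ and all $t\ge s$, $Z_{\overline{\pi_n}(s)\wedge t}-Z_{\underline{\pi_n}(s)\wedge t}\to\Delta Z_s$; (C3) for all $t\ge 0$, $\limsup_{\varepsilon\downarrow0}\limsup_{n\to\infty}\sup_{I\in\pi_n}\operatorname{diam}\big((Z-J_\varepsilon(Z))(I\cap[0,t])\big)=0$. * $(\pi_n)$ *approximates $Z$ from the left* if $Z_{\underline{\pi_n}(t)}\to Z_{t-}$ for all $t>0$. * $X$ has *finite 2-variation* along $(\pi_n)$ if $\sup_n\sum_{I\in\pi_n}\|\delta X_t(I)\|^2<\infty$ for all $t\ge 0$. A reasonable crossnorm on $E\otimes E$ is a norm $\alpha$ on the algebraic tensor product with $\alpha(x\otimes y)\le\|x\|\|y\|$ for all $x,y\in E$ and $\|x^*\otimes y^*\|_{(E\otimes E,\alpha)^*}\le\|x^*\|\|y^*\|$ for all $x^*,y^*\in E^*$; $E\widehat\otimes_\alpha E$ is the completion of $(E\otimes E,\alpha)$. A càdlàg path ${}^\alpha[X,X]$ of finite variation in $E\widehat\otimes_\alpha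 E$ is the *strong* (resp. *weak*) *$\alpha$-tensor quadratic variation* of $X$ along $(\pi_n)$ if, for every $t\ge0$, $\sum_{I\in\pi_n}\delta X_t(I)\otimes\delta X_t(I)\to{}^\alpha[X,X]_t$ in the norm (resp. weak) topology, and $\Delta\,{}^\alpha[X,X]_t=\Delta X_t\otimes\Delta X_t$. For Banach spaces $V,W$, $\mathcal L_{\mathrm c}(V,W)$ is the space of bounded operators with the topology generated by the seminorms $\rho_K(T)=\inf\{C>0:\ \|Tx\|\le C\|x\|\ \forall x\in K\}$, $K\subset V$ compact. For $g:[0,\infty)\to\mathcal L_{\mathrm c}(V,W)$ left continuous on $(0,\infty)$ with right limits on $[0,\infty)$ and a càdlàg path $h$ of finite variation in $V$, the Stieltjes integral $\int_0^t g_s\,\mathrm dh_s$ is the extension by continuity, with respect to uniform convergence in $\mathcal L_{\mathrm c}(V,W)$ on $(0,t]$, of $\sum_i 1_{(\tau_i,\tau_{i+1}]}T_i\mapsto\sum_i T_i(h_{\tau_{i+1}}-h_{\tau_i})$ from step functions on $(0,t]$. **Statement.** Let $\alpha$ be a reasonable crossnorm on $E\otimes E$, let $A:[0,\infty)\to F$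 be càdlàg of finite variation and let $X:[0,\infty)\to E$ be càdlàg. Let $(\pi_n)$ satisfy Condition (C) for $(A,X)$ (a path in $F\oplus E$ with the norm $\|a\|+\|x\|$) and approximate $(A,X)$ from the left. Suppose that $X$ has strong (resp. weak) $\alpha$-tensor quadratic variation ${}^\alpha[X,X]$ and finite 2-variation along $(\pi_n)$. Let $f:F\times E\to G$ be such that 1. $a\mapsto f(a,x)$ is Gâteaux differentiable for all $x\in E$, and $D_af:F\times E\to\mathcal L_{\mathrm c}(F,G)$ is continuous; 2. $x\mapsto f(a,x)$ is twice Gâteaux differentiable for all $a\in F$ (the second derivative being the Gâteaux derivative of $x\mapsto D_xf(a,x)$ as a map into $\mathcal L(E,G)$ with its operator norm), and $D_xf:F\times E\to\mathcal L_{\mathrm c}(E,G)$ is continuous; 3. the second derivative induces a continuous map $D_x^2f:F\times E\to\mathcal L_{\mathrm c}(E\widehat\otimes_\alpha E,G)$, that is, there is such a map with $D_x^2f(a,x)(u\otimes v)=\big(D_x(D_xf)(a,x)u\big)v$ for all $u,v\in E$. Then for every $t\ge0$ the Itô–Föllmer integral $$\int_0^tD_xf(A_{s-},X_{s-})\,\mathrm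 dX_s=\lim_{n\to\infty}\sum_{(r,s]\in\pi_n}D_xf(A_r,X_r)(X_{s\wedge t}-X_{r\wedge t})$$ exists in the norm (resp. weak) topology of $G$, the two Stieltjes integrals below exist, the sum over jumps converges unconditionally in $G$, and $$f(A_t,X_t)-f(A_0,X_0)=\int_0^tD_af(A_{s-},X_{s-})\,\mathrm dA^{\mathrm c}_s+\int_0^tD_xf(A_{s-},X_{s-})\,\mathrm dX_s+\frac12\int_0^tD_x^2f(A_{s-},X_{s-})\,\mathrm d\,{}^\alpha[X,X]^{\mathrm c}_s$$ $$\qquad+\sum_{0<s\le t}\big\{f(A_s,X_s)-f(A_{s-},X_{s-})-D_xf(A_{s-},X_{s-})\Delta X_s\big\}.$$ -/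

import Mathlib

open Filter Topology Set
open scoped NNReal ENNReal TensorProduct

noncomputable section

namespace ItoFollmer

/-! ### Paths -/

section Paths

variable {V : Type*}

/-- Càdlàg paths `[0, ∞) → V`: right continuous, with a left limit at every `t > 0`. -/
structure IsCadlag [TopologicalSpace V] (X : ℝ≥0 → V) : Prop where
  right_continuous : ∀ t, ContinuousWithinAt X (Ici t) t
  left_limit : ∀ t, 0 < t → ∃ l, Tendsto X (𝓝[<] t) (𝓝 l)

variable [NormedAddCommGroup V]

/-- The jump `ΔX_t = X_t - X_{t-}`. Mathlib's `Function.leftLim` is the left limit `X_{t-}` for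
`t > 0`, and `Function.leftLim X 0 = X 0`, so that `ΔX_0 = 0`. -/
def jump (X : ℝ≥0 → V) (t : ℝ≥0) : V := X t - Function.leftLim X t

/-- `D_ε(X)`, the set of times at which the jump of `X` has norm at least `ε`. -/
def bigJumps (X : ℝ≥0 → V) (ε : ℝ) : Set ℝ≥0 := {t | ε ≤ ‖jump X t‖}

/-- `J_ε(X)_t`, the sum of the jumps `ΔX_s` over `s ∈ (0, t] ∩ D_ε(X)` (a finite set
if `X` is càdlàg and `ε > 0`). -/
def bigJumpPart (X : ℝ≥0 → V) (ε : ℝ) (t : ℝ≥0) : V :=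
  ∑' s : ℝ≥0, (Ioc 0 t ∩ bigJumps X ε).indicator (jump X) s

/-- The continuous part `f^c_t = f_t - ∑_{0 < s ≤ t} Δf_s` of a càdlàg path of finite variation
(for such a path the sum is absolutely convergent). -/
def contPart (f : ℝ≥0 → V) (t : ℝ≥0) : V :=
  f t - ∑' s : ℝ≥0, (Ioc 0 t).indicator (jump f) s

/-- The path `(A, X)` in the direct sum `F ⊕ E` with the norm `‖a‖ + ‖x‖`. -/
def pairPath {F E : Type*} (A : ℝ≥0 → F) (X : ℝ≥0 → E) (t : ℝ≥0) : WithLp 1 (F × E) :=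
  WithLp.toLp 1 (A t, X t)

end Paths

/-! ### Partitions of the half line -/

/-- A partition `{(t_i, t_{i+1}] ; i ∈ ℕ}` of `[0, ∞)`, with `0 = t_0 < t_1 < ⋯ → ∞`. -/
structure Partition where
  pt : ℕ → ℝ≥0
  pt_zero : pt 0 = 0
  strictMono : StrictMono pt
  tendsto_atTop : Tendsto pt atTop atTop

namespace Partition

/-- The left endpoint of the interval of the partition that contains `t > 0`. -/
def lower (p : Partition) (t : ℝ≥0) : ℝ≥0 := sSup {r | r ∈ range p.pt ∧ r < t}

/-- The right endpoint of the interval of the partition that contains `t > 0`. -/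
def upper (p : Partition) (t : ℝ≥0) : ℝ≥0 := sInf {r | r ∈ range p.pt ∧ t ≤ r}

/-- The increment `δX_t(I) = X_{s ∧ t} - X_{r ∧ t}` over the `i`-th interval `I = (r, s]`. -/
def incr {V : Type*} [NormedAddCommGroup V] (p : Partition) (X : ℝ≥0 → V) (t : ℝ≥0) (i : ℕ) : V :=
  X (min (p.pt (i + 1)) t) - X (min (p.pt i) t)

/-- The oscillation `O⁺_t(X; π) = sup_{(r, s] ∈ π} ω(X; (r, s] ∩ [0, t])`,
where `ω(X; S)` is the diameter of `X(S)`. -/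
def osc {V : Type*} [NormedAddCommGroup V] (p : Partition) (X : ℝ≥0 → V) (t : ℝ≥0) : ℝ≥0∞ :=
  ⨆ i : ℕ, Metric.ediam (X '' (Ioc (p.pt i) (p.pt (i + 1)) ∩ Iic t))

end Partition

/-- Condition (C) of a sequence of partitions for a càdlàg path. -/
structure ConditionC {V : Type*} [NormedAddCommGroup V] (P : ℕ → Partition) (X : ℝ≥0 → V) :
    Prop where
  /-- (C1) -/
  separates : ∀ (t : ℝ≥0) (ε : ℝ), 0 < ε → ∃ N : ℕ, ∀ n ≥ N, ∀ i : ℕ,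
    (Ioc ((P n).pt i) ((P n).pt (i + 1)) ∩ Iic t ∩ bigJumps X ε).Subsingleton
  /-- (C2) -/
  recovers_jumps : ∀ s : ℝ≥0, jump X s ≠ 0 → ∀ t ≥ s,
    Tendsto (fun n ↦ X (min ((P n).upper s) t) - X (min ((P n).lower s) t)) atTop (𝓝 (jump X s))
  /-- (C3) -/
  controls_osc : ∀ t : ℝ≥0,
    limsup (fun ε : ℝ ↦ limsup (fun n ↦ (P n).osc (fun s ↦ X s - bigJumpPart X ε s) t) atTop)
      (𝓝[>] 0) = 0

/-- The sequence of partitions approximates `X` from the left. -/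
def ApproximatesFromLeft {V : Type*} [NormedAddCommGroup V] (P : ℕ → Partition) (X : ℝ≥0 → V) :
    Prop :=
  ∀ t : ℝ≥0, 0 < t → Tendsto (fun n ↦ X ((P n).lower t)) atTop (𝓝 (Function.leftLim X t))

/-- `X` has finite 2-variation along the sequence of partitions:
`sup_n ∑_{I ∈ π_n} ‖δX_t(I)‖² < ∞` for every `t`. (The sums have finitely many nonzero terms.) -/
def HasFiniteTwoVariation {V : Type*} [NormedAddCommGroup V] (P : ℕ → Partition) (X : ℝ≥0 → V) :
    Prop :=
  ∀ t : ℝ≥0, BddAbove (range fun n ↦ ∑' i : ℕ, ‖(P n).incr X t i‖ ^ 2)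

/-! ### Quadratic covariation and the Itô–Föllmer integral -/

/-- The two topologies of a normed space in which limits are taken. -/
inductive Mode
  | strong
  | weak

/-- Convergence of a sequence in the norm topology or in the weak topology. -/
def ConvergesIn {V : Type*} [NormedAddCommGroup V] [NormedSpace ℝ V] :
    Mode → (ℕ → V) → V → Prop
  | .strong, u, l => Tendsto u atTop (𝓝 l)
  | .weak, u, l => Tendsto (fun n ↦ toWeakSpace ℝ V (u n)) atTop (𝓝 (toWeakSpace ℝ V l))

section Covariation

variable {E F G : Type*} [NormedAddCommGroup E] [NormedSpace ℝ E]
  [NormedAddCommGroup F] [NormedSpace ℝ F] [NormedAddCommGroup G] [NormedSpace ℝ G]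

/-- `Q` is the (strong or weak) `B`-quadratic covariation of `X` and `Y` along `P`. -/
structure IsQuadraticCovariation (m : Mode) (B : E →L[ℝ] F →L[ℝ] G) (P : ℕ → Partition)
    (X : ℝ≥0 → E) (Y : ℝ≥0 → F) (Q : ℝ≥0 → G) : Prop where
  cadlag : IsCadlag Q
  finiteVariation : LocallyBoundedVariationOn Q univ
  converges : ∀ t : ℝ≥0,
    ConvergesIn m (fun n ↦ ∑' i : ℕ, B ((P n).incr X t i) ((P n).incr Y t i)) (Q t)
  jump_eq : ∀ t : ℝ≥0, jump Q t = B (jump X t) (jump Y t)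

/-- `J` is the (strong or weak) Itô–Föllmer integral `∫_0^t ξ_{s-} dX_s` along `P`: the limit of
the left-side Riemann sums `∑_{(r, s] ∈ π_n} ξ_r (X_{s ∧ t} - X_{r ∧ t})`. -/
def IsItoFollmerIntegral (m : Mode) (P : ℕ → Partition) (ξ : ℝ≥0 → E →L[ℝ] G) (X : ℝ≥0 → E)
    (t : ℝ≥0) (J : G) : Prop :=
  ConvergesIn m (fun n ↦ ∑' i : ℕ, ξ ((P n).pt i) ((P n).incr X t i)) J

/-! ### The space `L_c(E, G)`, and Stieltjes integrals of `L_c(E, G)`-valued paths -/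

/-- The seminorm `ρ_K(T) = inf {C > 0 | ∀ x ∈ K, ‖T x‖ ≤ C ‖x‖}` on bounded operators. -/
def rho (K : Set E) (T : E →L[ℝ] G) : ℝ := sInf {C : ℝ | 0 < C ∧ ∀ x ∈ K, ‖T x‖ ≤ C * ‖x‖}

/-- Continuity of an operator-valued map for the locally convex topology of `L_c(E, G)`, which is
generated by the seminorms `ρ_K`, `K ⊆ E` compact. -/
def ContinuousLc {S : Type*} [TopologicalSpace S] (T : S → E →L[ℝ] G) : Prop :=
  ∀ K : Set E, IsCompact K → ∀ p : S, Tendsto (fun q ↦ rho K (T q - T p)) (𝓝 p) (𝓝 0)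

variable (E G) in
/-- An operator-valued step function `∑_{i < n} 1_{(τ_i, τ_{i+1}]} T_i` on `(0, t]`,
where `0 = τ_0 < ⋯ < τ_n = t`. -/
structure StepFunction (t : ℝ≥0) where
  n : ℕ
  τ : ℕ → ℝ≥0
  τ_zero : τ 0 = 0
  τ_last : τ n = t
  τ_lt : ∀ i < n, τ i < τ (i + 1)
  val : ℕ → E →L[ℝ] G

namespace StepFunction

variable {t : ℝ≥0}

/-- The integral `∑_{i < n} T_i (f(τ_{i+1}) - f(τ_i))` of a step function against `df`. -/
def integral (h : StepFunction E G t) (f : ℝ≥0 → E) : G :=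
  ∑ i ∈ Finset.range h.n, h.val i (f (h.τ (i + 1)) - f (h.τ i))

/-- The step function satisfies `ρ_K(g(s) - h(s)) ≤ δ` for all `s ∈ (0, t]`. -/
def IsNear (h : StepFunction E G t) (g : ℝ≥0 → E →L[ℝ] G) (K : Set E) (δ : ℝ) : Prop :=
  ∀ i < h.n, ∀ s ∈ Ioc (h.τ i) (h.τ (i + 1)), rho K (g s - h.val i) ≤ δ

end StepFunction

/-- `I` is the Stieltjes integral `∫_{(0, t]} g(s) df(s)`: the value at `g` of the extension by
continuity, from step functions, of the integral against `df`, with respect to the topology of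
uniform convergence on `(0, t]` in `L_c(E, G)`. The first conjunct says that `g` lies in the
closure of the step functions, so that `I` is unique. -/
def IsStieltjesIntegral (g : ℝ≥0 → E →L[ℝ] G) (f : ℝ≥0 → E) (t : ℝ≥0) (I : G) : Prop :=
  (∀ K : Set E, IsCompact K → ∀ δ > 0, ∃ h : StepFunction E G t, h.IsNear g K δ) ∧
  ∀ ε > 0, ∃ K : Set E, IsCompact K ∧ ∃ δ > 0,
    ∀ h : StepFunction E G t, h.IsNear g K δ → ‖h.integral f - I‖ ≤ ε

/-- `L` is the Gâteaux derivative of `f` at `x`. -/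
def HasGateauxDerivAt (f : E → G) (L : E →L[ℝ] G) (x : E) : Prop :=
  ∀ h : E, HasLineDerivAt ℝ f (L h) x h

end Covariation

/-! ### Reasonable crossnorms and completed tensor products -/

section Tensor

variable (E F : Type*) [NormedAddCommGroup E] [NormedSpace ℝ E]
  [NormedAddCommGroup F] [NormedSpace ℝ F]

/-- A reasonable crossnorm on the algebraic tensor product `E ⊗ F`: a norm `α` such that
`α(x ⊗ y) ≤ ‖x‖ ‖y‖`, and such that `x* ⊗ y*` has operator norm at most `‖x*‖ ‖y*‖` on
`(E ⊗ F, α)`. -/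
structure ReasonableCrossnorm extends Seminorm ℝ (E ⊗[ℝ] F) where
  eq_zero_of_map_eq_zero : ∀ z, toFun z = 0 → z = 0
  map_tmul_le : ∀ (x : E) (y : F), toFun (x ⊗ₜ[ℝ] y) ≤ ‖x‖ * ‖y‖
  dual_le : ∀ (φ : StrongDual ℝ E) (ψ : StrongDual ℝ F) (z : E ⊗[ℝ] F),
    |TensorProduct.dualDistrib ℝ E F ((φ : E →ₗ[ℝ] ℝ) ⊗ₜ[ℝ] (ψ : F →ₗ[ℝ] ℝ)) z|
      ≤ ‖φ‖ * ‖ψ‖ * toFun z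

variable {E F}

namespace ReasonableCrossnorm

/-- The algebraic tensor product `E ⊗ F`, to be normed by `α`. -/
def Alg (_α : ReasonableCrossnorm E F) : Type _ := E ⊗[ℝ] F

variable (α : ReasonableCrossnorm E F)

instance : AddCommGroup α.Alg := inferInstanceAs (AddCommGroup (E ⊗[ℝ] F))

instance : Module ℝ α.Alg := inferInstanceAs (Module ℝ (E ⊗[ℝ] F))

instance : Norm α.Alg := ⟨fun z ↦ α.toSeminorm z⟩

theorem alg_core : NormedSpace.Core ℝ α.Alg where
  norm_nonneg z := apply_nonneg α.toSeminorm z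
  norm_smul c z := map_smul_eq_mul α.toSeminorm c z
  norm_triangle x y := map_add_le_add α.toSeminorm x y
  norm_eq_zero_iff z :=
    ⟨fun h ↦ α.eq_zero_of_map_eq_zero z h, fun h ↦ by subst h; exact map_zero α.toSeminorm⟩

instance : NormedAddCommGroup α.Alg := NormedAddCommGroup.ofCore α.alg_core

instance : NormedSpace ℝ α.Alg := NormedSpace.ofCore α.alg_core

/-- The completed tensor product `E ⊗̂_α F`, the completion of `(E ⊗ F, α)`. -/
abbrev Completed : Type _ := UniformSpace.Completion α.Alg

/-- The bilinear map `(x, y) ↦ x ⊗ y` into `(E ⊗ F, α)`. -/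
def algTmul : E →ₗ[ℝ] F →ₗ[ℝ] α.Alg := TensorProduct.mk ℝ E F

/-- The canonical bounded bilinear map `E × F → E ⊗̂_α F`. -/
def tmul : E →L[ℝ] F →L[ℝ] α.Completed :=
  LinearMap.mkContinuous₂
    (α.algTmul.compr₂ (UniformSpace.Completion.toComplL (𝕜 := ℝ) (E := α.Alg)).toLinearMap) 1
    (fun x y ↦ by
      have h : ‖((α.algTmul x y : α.Alg) : α.Completed)‖ ≤ ‖x‖ * ‖y‖ := by
        rw [UniformSpace.Completion.norm_coe]
        exact α.map_tmul_le x y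
      simpa using h)

end ReasonableCrossnorm

/-- `Q` is the (strong or weak) `α`-tensor quadratic variation of `X` along `P`. -/
def IsTensorQuadraticVariation (m : Mode) (α : ReasonableCrossnorm E E) (P : ℕ → Partition)
    (X : ℝ≥0 → E) (Q : ℝ≥0 → α.Completed) : Prop :=
  IsQuadraticCovariation m α.tmul P X X Q

end Tensor

end ItoFollmer

end

open ItoFollmer

/-!
The formula is obtained by expanding `f(A_t, X_t) - f(A_0, X_0)` along the partitions. Over each
interval of the `n`-th partition the increment of `f` is written as a Taylor polynomial at the left
endpoint, of first order in `A` and of second order in `X`, plus a remainder. Four sums result. One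
is the Itô–Föllmer Riemann sum, so that it converges once the other three do.

* The sums of `D_a f δA` and of `D²_x f (δX ⊗ δX)` converge to the Stieltjes integrals of the left
  limits of `D_a f(A, X)` and `D²_x f(A, X)` against `A` and against the quadratic variation
  (`convergesIn_riemannSum`). The integrand, a càdlàg path, is replaced by its values at the left
  endpoints of a fixed subdivision on whose cells it hardly oscillates; the total size of the
  contributions is bounded by the variation of `A` and by the 2-variation of `X`. An interval that
  straddles a point of the subdivision causes no error in the limit: either the integrand is
  continuous there, or `(A, X)` jumps there, and then (C2) makes the increment after it negligible.
* The remainders converge in norm to the sum of the remainders at the jumps of `(A, X)`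
  (`tendsto_tsum_remainder`): each big jump is picked up by one interval, the other intervals have
  small increments by (C3), and the remainder is then small with respect to `‖δA‖ + ‖δX‖²`
  (`exists_norm_taylorRem_le`).

Splitting off the jumps of the integrators (`IsStepLimit.eq_add_tsum_jump`) and combining them with
the remainders at the jumps gives the sum over jumps in the formula. It converges absolutely, because
`‖ΔX ⊗ ΔX‖ = ‖ΔX‖²` is the jump of a path of finite variation (`ReasonableCrossnorm.norm_tmul`).

Two facts keep the analysis elementary. On a metric domain, continuity into `L_c` is continuity in
operator norm (`ContinuousLc.continuous`). And the increments of a path of finite variation on a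
compact interval lie in one compact set, whose seminorm therefore controls the integrals of step
functions (`IsStepLimit.isStieltjesIntegral`).
-/

namespace ItoFollmer
open Function (leftLim)

/-! ### Càdlàg paths -/

section Cadlag

variable {V W : Type*}

theorem IsCadlag.tendsto_leftLim [TopologicalSpace V] {X : ℝ≥0 → V} (hX : IsCadlag X)
    {t : ℝ≥0} (ht : 0 < t) : Tendsto X (𝓝[<] t) (𝓝 (leftLim X t)) :=
  tendsto_leftLim_of_tendsto (hX.left_limit t ht)

theorem nhdsLT_neBot {t : ℝ≥0} (ht : 0 < t) : (𝓝[<] t).NeBot :=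
  nhdsLT_neBot_of_exists_lt ⟨0, ht⟩

theorem leftLim_eq [TopologicalSpace V] [T2Space V] {X : ℝ≥0 → V} {t : ℝ≥0} (ht : 0 < t) {l : V}
    (h : Tendsto X (𝓝[<] t) (𝓝 l)) : leftLim X t = l := by
  have := nhdsLT_neBot ht
  exact leftLim_eq_of_tendsto h

theorem IsCadlag.comp [TopologicalSpace V] [TopologicalSpace W] {X : ℝ≥0 → V}
    (hX : IsCadlag X) {φ : V → W} (hφ : Continuous φ) : IsCadlag fun s ↦ φ (X s) where
  right_continuous t := hφ.continuousAt.comp_continuousWithinAt (hX.right_continuous t)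
  left_limit _ ht := ⟨_, (hφ.tendsto _).comp (hX.tendsto_leftLim ht)⟩

theorem IsCadlag.leftLim_comp [TopologicalSpace V] [TopologicalSpace W] [T2Space W] {X : ℝ≥0 → V}
    (hX : IsCadlag X) {φ : V → W} (hφ : Continuous φ) {t : ℝ≥0} (ht : 0 < t) :
    leftLim (fun s ↦ φ (X s)) t = φ (leftLim X t) :=
  leftLim_eq ht ((hφ.tendsto _).comp (hX.tendsto_leftLim ht))

theorem IsCadlag.prodMk [TopologicalSpace V] [TopologicalSpace W] {X : ℝ≥0 → V} {Y : ℝ≥0 → W}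
    (hX : IsCadlag X) (hY : IsCadlag Y) : IsCadlag fun s ↦ (X s, Y s) where
  right_continuous t := (hX.right_continuous t).prodMk (hY.right_continuous t)
  left_limit _ ht :=
    ⟨_, (hX.tendsto_leftLim ht).prodMk_nhds (hY.tendsto_leftLim ht)⟩

theorem IsCadlag.leftLim_prodMk [TopologicalSpace V] [TopologicalSpace W] [T2Space V] [T2Space W]
    {X : ℝ≥0 → V} {Y : ℝ≥0 → W} (hX : IsCadlag X) (hY : IsCadlag Y) {t : ℝ≥0} (ht : 0 < t) :
    leftLim (fun s ↦ (X s, Y s)) t = (leftLim X t, leftLim Y t) :=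
  leftLim_eq ht ((hX.tendsto_leftLim ht).prodMk_nhds (hY.tendsto_leftLim ht))

theorem IsCadlag.tendsto_right [TopologicalSpace V] {X : ℝ≥0 → V} (hX : IsCadlag X) (t : ℝ≥0) :
    Tendsto X (𝓝[>] t) (𝓝 (X t)) :=
  (hX.right_continuous t).mono_left (nhdsWithin_mono _ Ioi_subset_Ici_self)

end Cadlag

/-! ### Subdivisions of a compact interval -/

section Subdivision

theorem le_of_subdivision {n : ℕ} {τ : ℕ → ℝ≥0} (h : ∀ i < n, τ i < τ (i + 1)) {i j : ℕ}
    (hij : i ≤ j) (hj : j ≤ n) : τ i ≤ τ j := by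
  induction j, hij using Nat.le_induction with
  | base => exact le_rfl
  | succ j _ ih => exact (ih (by omega)).trans (h j (by omega)).le

theorem exists_mem_Ioc_of_subdivision {n : ℕ} {τ : ℕ → ℝ≥0} (h0 : τ 0 = 0) {s : ℝ≥0} (hs : 0 < s)
    (hsn : s ≤ τ n) : ∃ i < n, s ∈ Ioc (τ i) (τ (i + 1)) := by
  induction n with
  | zero => rw [h0] at hsn; exact absurd hsn (not_le.2 hs)
  | succ n ih =>
    rcases le_or_gt s (τ n) with h | h
    · obtain ⟨i, hi, h'⟩ := ih h
      exact ⟨i, by omega, h'⟩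
    · exact ⟨n, by omega, h, hsn⟩

theorem exists_mem_Ico_of_subdivision {n : ℕ} {τ : ℕ → ℝ≥0} (h0 : τ 0 = 0) {s : ℝ≥0}
    (hsn : s < τ n) : ∃ i < n, s ∈ Ico (τ i) (τ (i + 1)) := by
  induction n with
  | zero => rw [h0] at hsn; exact absurd hsn not_lt_zero
  | succ n ih =>
    rcases lt_or_ge s (τ n) with h | h
    · obtain ⟨i, hi, h'⟩ := ih h
      exact ⟨i, by omega, h'⟩
    · exact ⟨n, by omega, h, hsn⟩

/-- A càdlàg path on a compact interval oscillates by less than `η` on the half-open cells of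
some finite subdivision. -/
theorem IsCadlag.exists_subdivision {V : Type*} [PseudoMetricSpace V] {X : ℝ≥0 → V}
    (hX : IsCadlag X) (t : ℝ≥0) {η : ℝ} (hη : 0 < η) :
    ∃ (n : ℕ) (τ : ℕ → ℝ≥0), τ 0 = 0 ∧ τ n = t ∧ (∀ i < n, τ i < τ (i + 1)) ∧
      ∀ i < n, ∀ s ∈ Ico (τ i) (τ (i + 1)), dist (X s) (X (τ i)) < η := by
  set P : ℝ≥0 → Prop := fun x ↦ ∃ (n : ℕ) (τ : ℕ → ℝ≥0), τ 0 = 0 ∧ τ n = x ∧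
    (∀ i < n, τ i < τ (i + 1)) ∧
      ∀ i < n, ∀ s ∈ Ico (τ i) (τ (i + 1)), dist (X s) (X (τ i)) < η with hP
  have extend : ∀ x y, P x → x < y → (∀ s ∈ Ico x y, dist (X s) (X x) < η) → P y := by
    rintro x y ⟨n, τ, h0, hn, hlt, hd⟩ hxy hs
    refine ⟨n + 1, fun i ↦ if i ≤ n then τ i else y, by simp [h0], by simp, ?_, ?_⟩
    · intro i hi
      rcases Nat.lt_succ_iff_lt_or_eq.1 hi with h | rfl
      · simpa [h.le, Nat.succ_le_of_lt h] using hlt i h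
      · simpa [hn] using hxy
    · intro i hi
      rcases Nat.lt_succ_iff_lt_or_eq.1 hi with h | rfl
      · simpa [h.le, Nat.succ_le_of_lt h] using hd i h
      · simpa [hn] using hs
  have hP0 : P 0 := ⟨0, fun _ ↦ 0, rfl, rfl, by simp, by simp⟩
  set S : Set ℝ≥0 := {y | y ≤ t ∧ P y}
  have hSne : S.Nonempty := ⟨0, zero_le, hP0⟩
  have hSb : BddAbove S := ⟨t, fun y hy ↦ hy.1⟩
  set x := sSup S with hx
  have hxt : x ≤ t := csSup_le hSne fun y hy ↦ hy.1
  have hPx : P x := by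
    rcases eq_or_ne x 0 with h | h
    · rw [h]; exact hP0
    have hx0 : 0 < x := pos_iff_ne_zero.2 h
    have h1 := (hX.tendsto_leftLim hx0).eventually (Metric.ball_mem_nhds _ (half_pos hη))
    obtain ⟨l, hl, hl'⟩ := (mem_nhdsLT_iff_exists_Ioo_subset' hx0).1 h1
    obtain ⟨z, hzS, hz⟩ := exists_lt_of_lt_csSup hSne hl
    rcases (le_csSup hSb hzS).eq_or_lt with e | e
    · rw [hx, ← e]; exact hzS.2
    refine extend z x hzS.2 e fun s hs ↦ ?_
    have a1 : dist (X s) (leftLim X x) < η / 2 := hl' ⟨lt_of_lt_of_le hz hs.1, hs.2⟩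
    have a2 : dist (X z) (leftLim X x) < η / 2 := hl' ⟨hz, e⟩
    linarith [dist_triangle_right (X s) (X z) (leftLim X x)]
  rcases hxt.eq_or_lt with e | e
  · rw [← e]; exact hPx
  exfalso
  have h1 := (hX.right_continuous x).eventually (Metric.ball_mem_nhds _ hη)
  obtain ⟨u, hu, hu'⟩ := (mem_nhdsGE_iff_exists_Ico_subset' e).1 h1
  have hy : P (min u t) := extend x _ hPx (lt_min hu e)
    fun s hs ↦ hu' ⟨hs.1, hs.2.trans_le (min_le_left _ _)⟩
  exact absurd (le_csSup hSb (show min u t ∈ S from ⟨min_le_right _ _, hy⟩))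
    (not_le.2 (lt_min hu e))

theorem IsCadlag.totallyBounded {V : Type*} [PseudoMetricSpace V] {X : ℝ≥0 → V}
    (hX : IsCadlag X) (t : ℝ≥0) : TotallyBounded (X '' Iic t) := by
  refine Metric.totallyBounded_iff.2 fun ε hε ↦ ?_
  obtain ⟨n, τ, h0, hn, hlt, hd⟩ := hX.exists_subdivision t hε
  refine ⟨(fun i ↦ X (τ i)) '' Iic n, (finite_Iic n).image _, ?_⟩
  rintro _ ⟨s, hs, rfl⟩
  simp only [mem_iUnion, Metric.mem_ball, exists_prop]
  rcases (show s ≤ t from hs).eq_or_lt with e | e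
  · exact ⟨_, mem_image_of_mem _ (mem_Iic.2 (le_refl n)), by simp [hn, e, hε]⟩
  · obtain ⟨i, hi, hsi⟩ := exists_mem_Ico_of_subdivision h0 (hn.symm ▸ e)
    exact ⟨_, mem_image_of_mem _ (mem_Iic.2 hi.le), hd i hi s hsi⟩

theorem IsCadlag.isCompact_closure {V : Type*} [PseudoMetricSpace V] [CompleteSpace V]
    {X : ℝ≥0 → V} (hX : IsCadlag X) (t : ℝ≥0) : IsCompact (closure (X '' Iic t)) :=
  (hX.totallyBounded t).closure.isCompact_of_isClosed isClosed_closure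

theorem IsCadlag.leftLim_mem_closure {V : Type*} [TopologicalSpace V]
    {X : ℝ≥0 → V} (hX : IsCadlag X) {s t : ℝ≥0} (hs : 0 < s) (hst : s ≤ t) :
    leftLim X s ∈ closure (X '' Iic t) := by
  have := nhdsLT_neBot hs
  refine mem_closure_of_tendsto (hX.tendsto_leftLim hs) ?_
  filter_upwards [self_mem_nhdsWithin] with r hr
  exact mem_image_of_mem _ (le_trans (le_of_lt hr) hst)

theorem IsCadlag.exists_bound {V : Type*} [NormedAddCommGroup V] {X : ℝ≥0 → V}
    (hX : IsCadlag X) (t : ℝ≥0) : ∃ C, 0 ≤ C ∧ ∀ s ≤ t, ‖X s‖ ≤ C := by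
  obtain ⟨C, hC⟩ := (hX.totallyBounded t).isBounded.exists_norm_le
  exact ⟨max C 0, le_max_right _ _,
    fun s hs ↦ (hC _ (mem_image_of_mem _ hs)).trans (le_max_left _ _)⟩

/-- A càdlàg path has finitely many jumps of size at least `ε` on a compact interval. -/
theorem IsCadlag.finite_bigJumps {V : Type*} [NormedAddCommGroup V] {X : ℝ≥0 → V}
    (hX : IsCadlag X) (t : ℝ≥0) {ε : ℝ} (hε : 0 < ε) : (Ioc 0 t ∩ bigJumps X ε).Finite := by
  obtain ⟨n, τ, h0, hn, hlt, hd⟩ := hX.exists_subdivision t (show 0 < ε / 3 by positivity)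
  refine ((finite_Iic n).image τ).subset ?_
  rintro s ⟨⟨hs0, hst⟩, hsb⟩
  by_contra hcon
  obtain ⟨i, hi, hsi⟩ := exists_mem_Ioc_of_subdivision h0 hs0 (hn.symm ▸ hst)
  have hne : s ≠ τ (i + 1) := fun e ↦ hcon ⟨i + 1, mem_Iic.2 hi, e.symm⟩
  have hslt : s < τ (i + 1) := lt_of_le_of_ne hsi.2 hne
  have h1 : ‖X s - X (τ i)‖ < ε / 3 := by
    rw [← dist_eq_norm]; exact hd i hi s ⟨hsi.1.le, hslt⟩
  have h2 : ‖leftLim X s - X (τ i)‖ ≤ ε / 3 := by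
    have := nhdsLT_neBot hs0
    refine le_of_tendsto ((hX.tendsto_leftLim hs0).sub_const _).norm ?_
    filter_upwards [Ioo_mem_nhdsLT hsi.1] with r hr
    rw [← dist_eq_norm]; exact (hd i hi r ⟨hr.1.le, hr.2.trans hslt⟩).le
  have h3 : ‖jump X s‖ ≤ ‖X s - X (τ i)‖ + ‖leftLim X s - X (τ i)‖ := by
    rw [jump, show X s - leftLim X s = (X s - X (τ i)) - (leftLim X s - X (τ i)) by abel]
    exact norm_sub_le _ _
  have h4 : ε ≤ ‖jump X s‖ := hsb
  linarith

end Subdivision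

/-! ### Partitions -/

namespace Partition

variable (p : Partition)

/-- The index `i` of the interval `(t_i, t_{i+1}]` of the partition that contains `s > 0`. -/
noncomputable def index (s : ℝ≥0) : ℕ := sInf {i | s ≤ p.pt (i + 1)}

theorem exists_le (t : ℝ≥0) : ∃ N, ∀ i ≥ N, t ≤ p.pt i :=
  eventually_atTop.1 (p.tendsto_atTop.eventually_ge_atTop t)

theorem le_pt_index (s : ℝ≥0) : s ≤ p.pt (p.index s + 1) := by
  obtain ⟨N, hN⟩ := p.exists_le s
  exact Nat.sInf_mem (s := {i | s ≤ p.pt (i + 1)}) ⟨N, hN _ (Nat.le_succ N)⟩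

theorem pt_index_lt {s : ℝ≥0} (hs : 0 < s) : p.pt (p.index s) < s := by
  rcases h : p.index s with _ | k
  · rwa [p.pt_zero]
  · have : k ∉ {i | s ≤ p.pt (i + 1)} := Nat.notMem_of_lt_sInf (by
      change k < p.index s
      omega)
    exact not_le.1 this

variable {p}

theorem index_eq {s : ℝ≥0} {i : ℕ} (h1 : p.pt i < s) (h2 : s ≤ p.pt (i + 1)) :
    p.index s = i := by
  have h3 := p.pt_index_lt (lt_of_le_of_lt zero_le h1)
  have h4 := p.le_pt_index s
  have h5 := p.strictMono.lt_iff_lt.1 (h3.trans_le h2)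
  have h6 := p.strictMono.lt_iff_lt.1 (h1.trans_le h4)
  omega

theorem lower_eq {s : ℝ≥0} (hs : 0 < s) : p.lower s = p.pt (p.index s) := by
  refine IsGreatest.csSup_eq ⟨⟨mem_range_self _, p.pt_index_lt hs⟩, ?_⟩
  rintro _ ⟨⟨j, rfl⟩, hj⟩
  have := p.strictMono.lt_iff_lt.1 (lt_of_lt_of_le hj (p.le_pt_index s))
  exact p.strictMono.monotone (by omega)

theorem upper_eq {s : ℝ≥0} (hs : 0 < s) : p.upper s = p.pt (p.index s + 1) := by
  refine IsLeast.csInf_eq ⟨⟨mem_range_self _, p.le_pt_index s⟩, ?_⟩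
  rintro _ ⟨⟨j, rfl⟩, hj⟩
  have := p.strictMono.lt_iff_lt.1 (lt_of_lt_of_le (p.pt_index_lt hs) hj)
  exact p.strictMono.monotone (by omega)

theorem incr_eq_zero {V : Type*} [NormedAddCommGroup V] (X : ℝ≥0 → V) {t : ℝ≥0} {i : ℕ}
    (h : t ≤ p.pt i) : p.incr X t i = 0 := by
  have h' : t ≤ p.pt (i + 1) := h.trans (p.strictMono (Nat.lt_succ_self i)).le
  simp [incr, h, h']

theorem tsum_eq_sum_range {V : Type*} [AddCommMonoid V] [TopologicalSpace V]
    {q : ℕ → V} {t : ℝ≥0} (hq : ∀ i, t ≤ p.pt i → q i = 0) {N : ℕ}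
    (hN : t ≤ p.pt N) : ∑' i, q i = ∑ i ∈ Finset.range N, q i :=
  tsum_eq_sum fun i hi ↦ hq i (hN.trans (p.strictMono.monotone (by simpa using hi)))

end Partition

/-! ### Sums over half-open intervals -/

section CumSum

variable {V : Type*} [NormedAddCommGroup V]

theorem tsum_indicator_sub {φ : ℝ≥0 → V} (hφ : ∀ t, Summable ((Ioc 0 t).indicator φ)) {a b : ℝ≥0}
    (hab : a ≤ b) : ∑' u, (Ioc 0 b).indicator φ u - ∑' u, (Ioc 0 a).indicator φ u
      = ∑' u, (Ioc a b).indicator φ u := by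
  rw [← (hφ b).tsum_sub (hφ a)]
  refine tsum_congr fun u ↦ ?_
  rcases le_or_gt u a with h | h
  · simp [indicator, h, h.trans hab, not_lt.2 h]
  · simp [indicator, h, not_le.2 h, lt_of_le_of_lt zero_le h]

theorem norm_tsum_indicator_sub_le [CompleteSpace V] {φ : ℝ≥0 → V} {w : ℝ≥0 → ℝ}
    (hw : ∀ t, Summable ((Ioc 0 t).indicator w)) {a b : ℝ≥0} (hab : a ≤ b)
    (hle : ∀ u ∈ Ioc a b, ‖φ u‖ ≤ w u) : ‖∑' u, (Ioc a b).indicator φ u‖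
      ≤ ∑' u, (Ioc 0 b).indicator w u - ∑' u, (Ioc 0 a).indicator w u := by
  have hs : Summable ((Ioc a b).indicator w) := by
    refine ((hw b).indicator (Ioc a b)).congr fun u ↦ ?_
    by_cases h : u ∈ Ioc a b
    · have h' : u ∈ Ioc 0 b := ⟨lt_of_le_of_lt zero_le h.1, h.2⟩
      simp only [indicator_of_mem h, indicator_of_mem h']
    · simp only [indicator_of_notMem h]
  rw [tsum_indicator_sub hw hab]
  refine tsum_of_norm_bounded hs.hasSum fun u ↦ ?_
  by_cases h : u ∈ Ioc a b
  · simpa only [indicator_of_mem h] using hle u h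
  · simp only [indicator_of_notMem h, norm_zero, le_refl]

end CumSum

/-! ### Paths of finite variation -/

section Variation

variable {V : Type*} [NormedAddCommGroup V]

/-- The increments of `H` are dominated by those of the real function `v`, which is then
nondecreasing. Every path of locally bounded variation is controlled by its variation function. -/
def ControlledBy (H : ℝ≥0 → V) (v : ℝ≥0 → ℝ) : Prop :=
  ∀ a b, a ≤ b → ‖H b - H a‖ ≤ v b - v a

theorem exists_controlledBy {H : ℝ≥0 → V} (hH : LocallyBoundedVariationOn H univ) :
    ∃ v, ControlledBy H v := by
  refine ⟨variationOnFromTo H univ 0, fun a b hab ↦ ?_⟩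
  rw [variationOnFromTo.sub_right hH (mem_univ _) (mem_univ _) (mem_univ _),
    variationOnFromTo.eq_of_le _ _ hab, ← dist_eq_norm, dist_edist]
  exact ENNReal.toReal_mono (hH a b (mem_univ _) (mem_univ _))
    (eVariationOn.edist_le H ⟨mem_univ _, hab, le_rfl⟩ ⟨mem_univ _, le_rfl, hab⟩)

variable {H : ℝ≥0 → V} {v : ℝ≥0 → ℝ}

theorem ControlledBy.mono (hv : ControlledBy H v) : Monotone v :=
  fun a b hab ↦ sub_nonneg.1 ((norm_nonneg _).trans (hv a b hab))

theorem ControlledBy.norm_jump_le (hv : ControlledBy H v) (hH : IsCadlag H) {a b : ℝ≥0}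
    (hab : a < b) : ‖jump H b‖ ≤ v b - v a := by
  have hb : 0 < b := lt_of_le_of_lt zero_le hab
  have := nhdsLT_neBot hb
  refine le_of_tendsto ((hH.tendsto_leftLim hb).const_sub _).norm ?_
  filter_upwards [Ioo_mem_nhdsLT hab] with r hr
  linarith [hv r b hr.2.le, hv.mono hr.1.le]

theorem ControlledBy.sum_norm_jump_le (hv : ControlledBy H v) (hH : IsCadlag H) (S : Finset ℝ≥0) :
    ∀ t, (∀ u ∈ S, u ∈ Ioc 0 t) → ∑ u ∈ S, ‖jump H u‖ ≤ v t - v 0 := by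
  induction S using Finset.induction_on_max with
  | empty => intro t _; simpa using hv.mono (zero_le (a := t))
  | insert a S hS ih =>
    intro t ht
    have ha := ht a (Finset.mem_insert_self _ _)
    rw [Finset.sum_insert fun h ↦ lt_irrefl _ (hS a h)]
    have hb : S.sup id < a := (Finset.sup_lt_iff ha.1).2 hS
    have h1 := ih (S.sup id) fun u hu ↦
      ⟨(ht u (Finset.mem_insert_of_mem hu)).1, Finset.le_sup (f := id) hu⟩
    linarith [hv.norm_jump_le hH hb, hv.mono ha.2]

/-- The jumps of a path of finite variation are absolutely summable on compact intervals. -/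
theorem ControlledBy.summable_norm_jump (hv : ControlledBy H v) (hH : IsCadlag H) (t : ℝ≥0) :
    Summable ((Ioc 0 t).indicator fun u ↦ ‖jump H u‖) := by
  classical
  refine summable_of_sum_le (c := v t - v 0)
    (fun u ↦ indicator_nonneg (fun _ _ ↦ norm_nonneg _) u) fun S ↦ ?_
  rw [Finset.sum_indicator_eq_sum_filter]
  exact hv.sum_norm_jump_le hH _ t fun u hu ↦ (Finset.mem_filter.1 hu).2

theorem ControlledBy.summable_jump [CompleteSpace V] (hv : ControlledBy H v) (hH : IsCadlag H)
    (t : ℝ≥0) : Summable ((Ioc 0 t).indicator (jump H)) := by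
  refine Summable.of_norm ((hv.summable_norm_jump hH t).congr fun u ↦ ?_)
  rw [norm_indicator_eq_indicator_norm]

/-- The continuous part of a path of finite variation is of finite variation: it is controlled by
the control of the path plus the cumulative size of its jumps. -/
theorem ControlledBy.contPart [CompleteSpace V] (hv : ControlledBy H v) (hH : IsCadlag H) :
    ControlledBy (contPart H)
      fun t ↦ v t + ∑' u, (Ioc 0 t).indicator (fun u ↦ ‖jump H u‖) u := by
  intro a b hab
  have h1 := norm_tsum_indicator_sub_le (φ := jump H) (hv.summable_norm_jump hH) hab
    fun u _ ↦ le_rfl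
  rw [← tsum_indicator_sub (hv.summable_jump hH) hab] at h1
  have e : ItoFollmer.contPart H b - ItoFollmer.contPart H a = (H b - H a)
      - (∑' u, (Ioc 0 b).indicator (jump H) u - ∑' u, (Ioc 0 a).indicator (jump H) u) := by
    simp only [ItoFollmer.contPart]; abel
  rw [e]
  refine (norm_sub_le _ _).trans ?_
  have h2 := hv a b hab
  linarith

/-- A path controlled by `v` is a `1`-Lipschitz function of `v`, whose values on `[0, t]` lie in a
compact interval. -/
theorem ControlledBy.totallyBounded (hv : ControlledBy H v) (t : ℝ≥0) :
    TotallyBounded (H '' Iic t) := by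
  have h1 : TotallyBounded (v '' Iic t) := (totallyBounded_Icc (v 0) (v t)).subset (by
    rintro _ ⟨s, hs, rfl⟩
    exact ⟨hv.mono zero_le, hv.mono hs⟩)
  refine Metric.totallyBounded_iff.2 fun ε hε ↦ ?_
  obtain ⟨k', hk', hk'f, hcov⟩ := exists_subset_image_finite_and.1
    (h1.exists_subset (Metric.dist_mem_uniformity hε))
  refine ⟨H '' k', hk'f.image _, ?_⟩
  rintro _ ⟨s, hs, rfl⟩
  have h2 := hcov (mem_image_of_mem v hs)
  simp only [mem_iUnion, exists_prop, mem_image, exists_exists_and_eq_and, mem_ofPred_eq,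
    Metric.mem_ball] at h2 ⊢
  obtain ⟨r, hr, hd⟩ := h2
  refine ⟨r, hr, lt_of_le_of_lt ?_ hd⟩
  rw [dist_eq_norm, Real.dist_eq]
  rcases le_total r s with h | h
  · exact (hv _ _ h).trans (le_abs_self _)
  · rw [norm_sub_rev, abs_sub_comm]; exact (hv _ _ h).trans (le_abs_self _)

/-- A compact set that contains all increments of `H` on `[0, t]`. -/
theorem ControlledBy.exists_isCompact [CompleteSpace V] (hv : ControlledBy H v) (t : ℝ≥0) :
    ∃ K : Set V, IsCompact K ∧ ∀ a ≤ t, ∀ b ≤ t, H b - H a ∈ K := by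
  have hC : IsCompact (closure (H '' Iic t)) :=
    (hv.totallyBounded t).closure.isCompact_of_isClosed isClosed_closure
  refine ⟨(fun z : V × V ↦ z.1 - z.2) '' (closure (H '' Iic t) ×ˢ closure (H '' Iic t)),
    (hC.prod hC).image (by fun_prop), fun a ha b hb ↦ ?_⟩
  exact ⟨(H b, H a), ⟨subset_closure (mem_image_of_mem _ hb),
    subset_closure (mem_image_of_mem _ ha)⟩, rfl⟩

end Variation

/-! ### Integrals of step functions -/

section Step

variable {V G : Type*} [NormedAddCommGroup V] [NormedSpace ℝ V]
  [NormedAddCommGroup G] [NormedSpace ℝ G]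

/-- The increment of `H` over the intersection of `[a, b]` with `[a', b']`, obtained by clamping the
endpoints of either interval to the other one. -/
theorem clamp_swap {V : Type*} [AddGroup V] (H : ℝ≥0 → V) {a b a' b' : ℝ≥0} (h : a ≤ b)
    (h' : a' ≤ b') :
    H (max a (min b b')) - H (max a (min b a')) = H (max a' (min b' b)) - H (max a' (min b' a)) := by
  rcases le_or_gt a b' with h1 | h1
  · rcases le_or_gt a' b with h2 | h2
    · rw [max_eq_right (le_min h h1), max_eq_right (le_min h' h2), min_eq_right h2, min_comm b' b,
        min_eq_right h1, max_comm]
    · rw [min_eq_left (h2.le.trans h'), min_eq_left h2.le, min_eq_right (h2.le.trans h'),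
        max_eq_left h2.le, min_eq_right (h.trans (h2.le.trans h')), max_eq_left (h.trans h2.le)]
      simp
  · rw [min_eq_right (h1.le.trans h), max_eq_left h1.le, min_eq_right (h'.trans (h1.le.trans h)),
      max_eq_left (h'.trans h1.le), min_eq_left (h1.le.trans h), min_eq_left h1.le]
    simp

namespace StepFunction

variable {t : ℝ≥0} (h : StepFunction V G t)

theorem τ_le {i : ℕ} (hi : i ≤ h.n) : h.τ i ≤ t :=
  (le_of_subdivision h.τ_lt hi le_rfl).trans_eq h.τ_last

theorem integral_add (H J : ℝ≥0 → V) :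
    h.integral (fun s ↦ H s + J s) = h.integral H + h.integral J := by
  simp only [integral, ← Finset.sum_add_distrib, ← map_add]
  exact Finset.sum_congr rfl fun i _ ↦ by congr 1; abel

/-- Refinement of the integral of a step function by the subdivision of a second one: the
increment over each cell is split at the points of the second subdivision, clamped to the cell. -/
theorem integral_refine {W : Type*} [NormedAddCommGroup W] [NormedSpace ℝ W]
    (h' : StepFunction W G t) (H : ℝ≥0 → V) :
    h.integral H = ∑ i ∈ Finset.range h.n, ∑ k ∈ Finset.range h'.n,
      h.val i (H (max (h.τ i) (min (h.τ (i + 1)) (h'.τ (k + 1))))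
        - H (max (h.τ i) (min (h.τ (i + 1)) (h'.τ k)))) := by
  refine Finset.sum_congr rfl fun i hi ↦ ?_
  rw [Finset.mem_range] at hi
  rw [← map_sum, Finset.sum_range_sub fun k ↦ H (max (h.τ i) (min (h.τ (i + 1)) (h'.τ k))),
    h'.τ_last, h'.τ_zero, min_eq_left (h.τ_le hi), max_eq_right (h.τ_lt i hi).le]
  simp

/-- The step function `h` is within `δ` of `g` on `(0, t]`, tested on the increments of `H`. -/
def IsClose (h : StepFunction V G t) (g : ℝ≥0 → V →L[ℝ] G) (H : ℝ≥0 → V) (δ : ℝ) : Prop :=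
  ∀ i < h.n, ∀ s ∈ Ioc (h.τ i) (h.τ (i + 1)), ∀ a ≤ t, ∀ b ≤ t,
    ‖(g s - h.val i) (H b - H a)‖ ≤ δ * ‖H b - H a‖

/-- The step function `h` is within `δ` of `g` on `(0, t]` in operator norm. -/
def IsNormClose (h : StepFunction V G t) (g : ℝ≥0 → V →L[ℝ] G) (δ : ℝ) : Prop :=
  ∀ i < h.n, ∀ s ∈ Ioc (h.τ i) (h.τ (i + 1)), ‖g s - h.val i‖ ≤ δ

variable {h}

theorem IsNormClose.isClose {g : ℝ≥0 → V →L[ℝ] G} {δ : ℝ} (hc : h.IsNormClose g δ)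
    (H : ℝ≥0 → V) : h.IsClose g H δ := fun i hi s hs _ _ _ _ ↦
  (ContinuousLinearMap.le_opNorm _ _).trans
    (mul_le_mul_of_nonneg_right (hc i hi s hs) (norm_nonneg _))

/-- Integrals of step functions close to the same `g` are close, by comparison on the common
refinement of their subdivisions. -/
theorem IsClose.norm_integral_sub_le {h' : StepFunction V G t} {g : ℝ≥0 → V →L[ℝ] G}
    {H : ℝ≥0 → V} {v : ℝ≥0 → ℝ} (hv : ControlledBy H v) {δ δ' : ℝ} (hδ : 0 ≤ δ) (hδ' : 0 ≤ δ')
    (hc : h.IsClose g H δ) (hc' : h'.IsClose g H δ') :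
    ‖h.integral H - h'.integral H‖ ≤ (δ + δ') * (v t - v 0) := by
  set x : ℕ → ℕ → ℝ≥0 := fun i k ↦ max (h.τ i) (min (h.τ (i + 1)) (h'.τ k)) with hx
  have e1 : h.integral H - h'.integral H = ∑ i ∈ Finset.range h.n, ∑ k ∈ Finset.range h'.n,
      (h.val i - h'.val k) (H (x i (k + 1)) - H (x i k)) := by
    rw [h.integral_refine h', h'.integral_refine h, Finset.sum_comm (s := Finset.range h'.n),
      ← Finset.sum_sub_distrib]
    refine Finset.sum_congr rfl fun i hi ↦ ?_
    rw [← Finset.sum_sub_distrib]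
    refine Finset.sum_congr rfl fun k hk ↦ ?_
    rw [Finset.mem_range] at hi hk
    rw [← clamp_swap H (h.τ_lt i hi).le (h'.τ_lt k hk).le]
    rfl
  have e2 : v t - v 0 = ∑ i ∈ Finset.range h.n, ∑ k ∈ Finset.range h'.n,
      (v (x i (k + 1)) - v (x i k)) := by
    have e := Finset.sum_range_sub (fun i ↦ v (h.τ i)) h.n
    rw [h.τ_last, h.τ_zero] at e
    rw [← e]
    refine Finset.sum_congr rfl fun i hi ↦ ?_
    rw [Finset.mem_range] at hi
    rw [Finset.sum_range_sub fun k ↦ v (x i k)]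
    simp only [hx]
    rw [h'.τ_last, h'.τ_zero, min_eq_left (h.τ_le hi), max_eq_right (h.τ_lt i hi).le]
    simp
  rw [e1, e2, Finset.mul_sum]
  refine norm_sum_le_of_le _ fun i hi ↦ ?_
  rw [Finset.mul_sum]
  refine norm_sum_le_of_le _ fun k hk ↦ ?_
  rw [Finset.mem_range] at hi hk
  have hxle : x i k ≤ x i (k + 1) :=
    max_le_max le_rfl (min_le_min le_rfl (h'.τ_lt k hk).le)
  have hxt : x i (k + 1) ≤ t :=
    max_le (h.τ_le hi.le) ((min_le_left _ _).trans (h.τ_le hi))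
  rcases hxle.eq_or_lt with e | e
  · rw [e]; simp
  -- a nondegenerate cell of the common refinement lies in one cell of each subdivision
  have hy : x i (k + 1) = min (h.τ (i + 1)) (h'.τ (k + 1)) := by
    rcases max_choice (h.τ i) (min (h.τ (i + 1)) (h'.τ (k + 1))) with h1 | h1
    · exact absurd e (not_lt.2 (h1.trans_le (le_max_left _ _)))
    · exact h1
  have m1 : x i (k + 1) ∈ Ioc (h.τ i) (h.τ (i + 1)) :=
    ⟨(le_max_left _ _).trans_lt e, hy.trans_le (min_le_left _ _)⟩
  have m2 : x i (k + 1) ∈ Ioc (h'.τ k) (h'.τ (k + 1)) := by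
    refine ⟨?_, hy.trans_le (min_le_right _ _)⟩
    have h2 : min (h.τ (i + 1)) (h'.τ k) < x i (k + 1) := (le_max_right _ _).trans_lt e
    rcases min_lt_iff.1 h2 with h3 | h3
    · exact absurd m1.2 (not_le.2 h3)
    · exact h3
  have b1 := hc i hi _ m1 (x i k) (hxle.trans hxt) _ hxt
  have b2 := hc' k hk _ m2 (x i k) (hxle.trans hxt) _ hxt
  have e3 : h.val i - h'.val k
      = (g (x i (k + 1)) - h'.val k) - (g (x i (k + 1)) - h.val i) := by abel
  rw [e3, sub_apply]
  refine (norm_sub_le _ _).trans ?_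
  calc _ ≤ δ' * ‖H (x i (k + 1)) - H (x i k)‖ + δ * ‖H (x i (k + 1)) - H (x i k)‖ := add_le_add b2 b1
    _ = (δ + δ') * ‖H (x i (k + 1)) - H (x i k)‖ := by ring
    _ ≤ _ := mul_le_mul_of_nonneg_left (hv _ _ hxle) (by positivity)

end StepFunction

/-- `I` is the limit of the integrals against `dH` of the step functions that approximate `g`, with
error at most `δ (v t - v 0)` if the step function is within `δ` of `g`. -/
def IsStepLimit (g : ℝ≥0 → V →L[ℝ] G) (H : ℝ≥0 → V) (v : ℝ≥0 → ℝ) (t : ℝ≥0) (I : G) : Prop :=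
  ∀ δ, 0 ≤ δ → ∀ h : StepFunction V G t, h.IsClose g H δ → ‖h.integral H - I‖ ≤ δ * (v t - v 0)

theorem exists_isStepLimit [CompleteSpace G] {g : ℝ≥0 → V →L[ℝ] G} {H : ℝ≥0 → V} {v : ℝ≥0 → ℝ}
    (hv : ControlledBy H v) {t : ℝ≥0}
    (hg : ∀ δ > 0, ∃ h : StepFunction V G t, h.IsNormClose g δ) : ∃ I, IsStepLimit g H v t I := by
  choose h hh using hg
  set d : ℕ → ℝ := fun n ↦ 1 / ((n : ℝ) + 1) with hd
  have hd0 : ∀ n, 0 < d n := fun n ↦ Nat.one_div_pos_of_nat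
  have hdlim : Tendsto d atTop (𝓝 0) := tendsto_one_div_add_atTop_nhds_zero_nat
  have hvt : 0 ≤ v t - v 0 := sub_nonneg.2 (hv.mono zero_le)
  have hcl : ∀ n, (h (d n) (hd0 n)).IsClose g H (d n) := fun n ↦ (hh _ (hd0 n)).isClose H
  have hC : CauchySeq fun n ↦ (h (d n) (hd0 n)).integral H := by
    refine cauchySeq_of_le_tendsto_0' (fun n ↦ (d n + d n) * (v t - v 0)) (fun n m hnm ↦ ?_) ?_
    · rw [dist_eq_norm]
      refine ((hcl n).norm_integral_sub_le hv (hd0 n).le (hd0 m).le (hcl m)).trans ?_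
      have : d m ≤ d n := one_div_le_one_div_of_le (by positivity) (by exact_mod_cast by omega)
      gcongr
    · simpa using (hdlim.add hdlim).mul_const (v t - v 0)
  obtain ⟨I, hI⟩ := cauchySeq_tendsto_of_complete hC
  refine ⟨I, fun δ hδ k hk ↦ ?_⟩
  have l1 : Tendsto (fun n ↦ (δ + d n) * (v t - v 0)) atTop (𝓝 (δ * (v t - v 0))) := by
    simpa using (hdlim.const_add δ).mul_const (v t - v 0)
  exact le_of_tendsto_of_tendsto' (hI.const_sub _).norm l1
    fun n ↦ hk.norm_integral_sub_le hv hδ (hd0 n).le (hcl n)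

/-! ### The seminorms of `L_c` -/

theorem rho_nonneg (K : Set V) (T : V →L[ℝ] G) : 0 ≤ rho K T :=
  Real.sInf_nonneg fun _ hC ↦ hC.1.le

theorem rho_bddBelow (K : Set V) (T : V →L[ℝ] G) :
    BddBelow {C : ℝ | 0 < C ∧ ∀ x ∈ K, ‖T x‖ ≤ C * ‖x‖} := ⟨0, fun _ hC ↦ hC.1.le⟩

theorem rho_le (K : Set V) (T : V →L[ℝ] G) {δ : ℝ} (hδ : 0 < δ) (h : ‖T‖ ≤ δ) : rho K T ≤ δ :=
  csInf_le (rho_bddBelow K T) ⟨hδ, fun x _ ↦ T.le_of_opNorm_le h x⟩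

theorem norm_le_rho_mul (T : V →L[ℝ] G) {K : Set V} {x : V} (hx : x ∈ K) :
    ‖T x‖ ≤ rho K T * ‖x‖ := by
  rcases eq_or_ne x 0 with rfl | h0
  · simp
  have hx0 : 0 < ‖x‖ := norm_pos_iff.2 h0
  rw [← div_le_iff₀ hx0]
  refine le_csInf ⟨‖T‖ + 1, by positivity, fun y _ ↦ ?_⟩ fun C hC ↦ ?_
  · exact T.le_of_opNorm_le (by linarith) y
  · rw [div_le_iff₀ hx0]; exact hC.2 x hx

/-- For a metric domain, continuity into `L_c` is continuity in operator norm: if the operator norms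
of `T_k` do not tend to `0`, unit vectors `x_k` that nearly attain these norms, scaled to
`x_k / (k + 1)`, form with `0` a compact set along which the seminorms see the norms. -/
theorem ContinuousLc.continuous {S : Type*} [TopologicalSpace S] [FirstCountableTopology S]
    {T : S → V →L[ℝ] G} (hT : ContinuousLc T) : Continuous T := by
  refine continuous_iff_continuousAt.2 fun p ↦ ?_
  refine tendsto_of_seq_tendsto fun q hq ↦ ?_
  rw [tendsto_iff_norm_sub_tendsto_zero]
  have hx : ∀ n, ∃ x : V, ‖x‖ ≤ 1 ∧ ‖T (q n) - T p‖ / 2 * ‖x‖ ≤ ‖(T (q n) - T p) x‖ ∧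
      (x = 0 → T (q n) - T p = 0) := by
    intro n
    rcases eq_or_ne (T (q n) - T p) 0 with h | h
    · exact ⟨0, by simp, by simp, fun _ ↦ h⟩
    have hpos : 0 < ‖T (q n) - T p‖ := norm_pos_iff.2 h
    obtain ⟨x, hx1, hx2⟩ := (T (q n) - T p).exists_lt_apply_of_lt_opNorm
      (show ‖T (q n) - T p‖ / 2 < ‖T (q n) - T p‖ by linarith)
    refine ⟨x, hx1.le, le_trans ?_ hx2.le, ?_⟩
    · exact mul_le_of_le_one_right (by positivity) hx1.le
    · rintro rfl
      rw [map_zero, norm_zero] at hx2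
      linarith
  choose x hx1 hx2 hx3 using hx
  set y : ℕ → V := fun n ↦ (1 / ((n : ℝ) + 1)) • x n with hy
  have hy0 : Tendsto y atTop (𝓝 0) := by
    refine squeeze_zero_norm (fun n ↦ ?_) tendsto_one_div_add_atTop_nhds_zero_nat
    rw [hy, norm_smul, Real.norm_of_nonneg Nat.one_div_pos_of_nat.le]
    exact mul_le_of_le_one_right Nat.one_div_pos_of_nat.le (hx1 n)
  have hK := (hT _ hy0.isCompact_insert_range p).comp hq
  refine squeeze_zero (fun n ↦ norm_nonneg _) (fun n ↦ ?_) (by simpa using hK.const_mul 2)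
  simp only [Function.comp_apply]
  rcases eq_or_ne (x n) 0 with h | h
  · rw [hx3 n h, norm_zero]; exact mul_nonneg zero_le_two (rho_nonneg _ _)
  have hmem : y n ∈ insert 0 (range y) := Or.inr (mem_range_self n)
  have h1 := norm_le_rho_mul (T (q n) - T p) hmem
  have hc : (0 : ℝ) < 1 / ((n : ℝ) + 1) := Nat.one_div_pos_of_nat
  have hxn : 0 < ‖x n‖ := norm_pos_iff.2 h
  simp only [hy, map_smul, norm_smul, Real.norm_of_nonneg hc.le] at h1
  rw [mul_left_comm] at h1
  have h2 := le_of_mul_le_mul_left h1 hc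
  have h3 := le_of_mul_le_mul_right ((hx2 n).trans h2) hxn
  linarith

/-- Step limits are Stieltjes integrals: the increments of `H` on `[0, t]` lie in a compact set,
whose seminorm controls the integral. -/
theorem IsStepLimit.isStieltjesIntegral [CompleteSpace V] {g : ℝ≥0 → V →L[ℝ] G} {H : ℝ≥0 → V}
    {v : ℝ≥0 → ℝ} (hv : ControlledBy H v) {t : ℝ≥0}
    (hg : ∀ δ > 0, ∃ h : StepFunction V G t, h.IsNormClose g δ) {I : G}
    (hI : IsStepLimit g H v t I) : IsStieltjesIntegral g H t I := by
  constructor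
  · intro K _ δ hδ
    obtain ⟨h, hh⟩ := hg δ hδ
    exact ⟨h, fun i hi s hs ↦ rho_le K _ hδ (hh i hi s hs)⟩
  · intro ε hε
    obtain ⟨K, hK, hmem⟩ := hv.exists_isCompact t
    have hvt : 0 ≤ v t - v 0 := sub_nonneg.2 (hv.mono zero_le)
    refine ⟨K, hK, ε / (v t - v 0 + 1), by positivity, fun h hh ↦ ?_⟩
    have hc : h.IsClose g H (ε / (v t - v 0 + 1)) := fun i hi s hs a ha b hb ↦
      (norm_le_rho_mul _ (hmem a ha b hb)).trans
        (mul_le_mul_of_nonneg_right (hh i hi s hs) (norm_nonneg _))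
    refine (hI _ (by positivity) h hc).trans ?_
    rw [div_mul_eq_mul_div, div_le_iff₀ (by positivity)]
    nlinarith

/-! ### Separation of the jumps from the integrator -/

variable {H : ℝ≥0 → V} {v : ℝ≥0 → ℝ}

/-- The integral against `dH` is the integral against the continuous part of `H` plus the sum of
the contributions of the jumps of `H`. -/
theorem IsStepLimit.eq_add_tsum_jump [CompleteSpace V] [CompleteSpace G] (hv : ControlledBy H v)
    (hH : IsCadlag H) {v' : ℝ≥0 → ℝ} (hv' : ControlledBy (contPart H) v')
    {g : ℝ≥0 → V →L[ℝ] G} {t : ℝ≥0}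
    (hg : ∀ δ > 0, ∃ h : StepFunction V G t, h.IsNormClose g δ)
    (hs : Summable ((Ioc 0 t).indicator fun u ↦ g u (jump H u))) {I I' : G}
    (hI : IsStepLimit g H v t I) (hI' : IsStepLimit g (contPart H) v' t I') :
    I = I' + ∑' u, (Ioc 0 t).indicator (fun u ↦ g u (jump H u)) u := by
  set φ : ℝ≥0 → G := (Ioc 0 t).indicator fun u ↦ g u (jump H u) with hφ
  have hφs : ∀ s, Summable ((Ioc 0 s).indicator φ) := fun s ↦ hs.indicator _
  have hφt : (Ioc 0 t).indicator φ = φ := by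
    rw [hφ, indicator_indicator, inter_self]
  set J : ℝ≥0 → V := fun s ↦ ∑' u, (Ioc 0 s).indicator (jump H) u with hJ
  set w : ℝ≥0 → ℝ := fun s ↦ ∑' u, (Ioc 0 s).indicator (fun u ↦ ‖jump H u‖) u with hw
  have hw0 : w 0 = 0 := by simp [hw]
  have hwt : 0 ≤ w t := tsum_nonneg fun u ↦ indicator_nonneg (fun _ _ ↦ norm_nonneg _) u
  have key : ∀ δ > 0, ∀ h : StepFunction V G t, h.IsNormClose g δ →
      ‖h.integral J - ∑' u, φ u‖ ≤ δ * w t := by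
    intro δ hδ h hh
    have e1 : ∑' u, φ u = ∑ i ∈ Finset.range h.n,
        ∑' u, (Ioc (h.τ i) (h.τ (i + 1))).indicator φ u := by
      have := Finset.sum_range_sub (fun i ↦ ∑' u, (Ioc 0 (h.τ i)).indicator φ u) h.n
      rw [h.τ_last, h.τ_zero, hφt] at this
      simp only [Ioc_self, indicator_empty, tsum_zero, sub_zero] at this
      rw [← this]
      refine Finset.sum_congr rfl fun i hi ↦ ?_
      exact tsum_indicator_sub hφs (h.τ_lt i (Finset.mem_range.1 hi)).le
    have e2 : w t = ∑ i ∈ Finset.range h.n, (w (h.τ (i + 1)) - w (h.τ i)) := by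
      rw [Finset.sum_range_sub fun i ↦ w (h.τ i), h.τ_last, h.τ_zero, hw0, sub_zero]
    rw [e1, e2, StepFunction.integral, ← Finset.sum_sub_distrib, Finset.mul_sum]
    refine norm_sum_le_of_le _ fun i hi ↦ ?_
    rw [Finset.mem_range] at hi
    have hlt := (h.τ_lt i hi).le
    have hmem : ∀ u ∈ Ioc (h.τ i) (h.τ (i + 1)), u ∈ Ioc 0 t := fun u hu ↦
      ⟨lt_of_le_of_lt zero_le hu.1, hu.2.trans (h.τ_le hi)⟩
    have hsJ : Summable ((Ioc (h.τ i) (h.τ (i + 1))).indicator (jump H)) := by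
      refine ((hv.summable_jump hH t).indicator (Ioc (h.τ i) (h.τ (i + 1)))).congr fun u ↦ ?_
      by_cases hu : u ∈ Ioc (h.τ i) (h.τ (i + 1))
      · simp only [indicator_of_mem hu, indicator_of_mem (hmem u hu)]
      · simp only [indicator_of_notMem hu]
    have hsφ : Summable ((Ioc (h.τ i) (h.τ (i + 1))).indicator φ) := hs.indicator _
    simp only [hJ]
    rw [tsum_indicator_sub (hv.summable_jump hH) hlt, (h.val i).map_tsum hsJ,
      ← (hsJ.mapL (h.val i)).tsum_sub hsφ]
    have e3 : ∀ u, h.val i ((Ioc (h.τ i) (h.τ (i + 1))).indicator (jump H) u)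
        - (Ioc (h.τ i) (h.τ (i + 1))).indicator φ u
        = (Ioc (h.τ i) (h.τ (i + 1))).indicator
          (fun u ↦ -((g u - h.val i) (jump H u))) u := by
      intro u
      by_cases hu : u ∈ Ioc (h.τ i) (h.τ (i + 1))
      · simp [indicator_of_mem hu, hφ, indicator_of_mem (hmem u hu)]
      · simp [indicator_of_notMem hu]
    simp_rw [e3]
    have hsw : ∀ s, Summable ((Ioc 0 s).indicator fun u ↦ δ * ‖jump H u‖) := fun s ↦ by
      refine ((hv.summable_norm_jump hH s).mul_left δ).congr fun u ↦ ?_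
      rw [indicator_const_mul]
    refine (norm_tsum_indicator_sub_le hsw hlt fun u hu ↦ ?_).trans (le_of_eq ?_)
    · rw [norm_neg]; exact ContinuousLinearMap.le_of_opNorm_le _ (hh i hi u hu) _
    · simp only [hw, mul_sub, indicator_const_mul, tsum_mul_left]
  have hvt : 0 ≤ v t - v 0 := sub_nonneg.2 (hv.mono zero_le)
  have hvt' : 0 ≤ v' t - v' 0 := sub_nonneg.2 (hv'.mono zero_le)
  have main : ∀ δ > 0, ‖I - (I' + ∑' u, φ u)‖ ≤ δ * ((v t - v 0) + (v' t - v' 0) + w t) := by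
    intro δ hδ
    obtain ⟨h, hh⟩ := hg δ hδ
    have b1 := hI δ hδ.le h (hh.isClose _)
    have b2 := hI' δ hδ.le h (hh.isClose _)
    have b3 := key δ hδ h hh
    have e : h.integral H = h.integral (ItoFollmer.contPart H) + h.integral J := by
      rw [← h.integral_add]
      congr 1
      funext s
      simp [ItoFollmer.contPart, hJ]
    have e' : I - (I' + ∑' u, φ u) = (h.integral (ItoFollmer.contPart H) - I')
        + (h.integral J - ∑' u, φ u) - (h.integral H - I) := by rw [e]; abel
    rw [e']
    refine (norm_sub_le _ _).trans ((add_le_add_left (norm_add_le _ _) _).trans ?_)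
    linarith
  rw [← sub_eq_zero, ← norm_le_zero_iff]
  refine le_of_forall_pos_le_add fun ε hε ↦ ?_
  refine (main (ε / ((v t - v 0) + (v' t - v' 0) + w t + 1)) (by positivity)).trans ?_
  rw [div_mul_eq_mul_div, div_le_iff₀ (by positivity)]
  nlinarith

end Step

/-! ### Convergence in the norm or the weak topology -/

section Mode

variable {V W : Type*} [NormedAddCommGroup V] [NormedSpace ℝ V] [NormedAddCommGroup W]
  [NormedSpace ℝ W] {m : Mode} {u u' : ℕ → V} {l l' : V}

theorem convergesIn_weak_iff :
    ConvergesIn .weak u l ↔ ∀ φ : StrongDual ℝ V, Tendsto (fun n ↦ φ (u n)) atTop (𝓝 (φ l)) := by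
  have hi : IsInducing fun (x : WeakSpace ℝ V) (φ : StrongDual ℝ V) ↦
      (topDualPairing ℝ V).flip x φ := ⟨rfl⟩
  exact hi.tendsto_nhds_iff.trans tendsto_pi_nhds

theorem ConvergesIn.of_tendsto (h : Tendsto u atTop (𝓝 l)) : ConvergesIn m u l := by
  cases m with
  | strong => exact h
  | weak => exact convergesIn_weak_iff.2 fun φ ↦ (φ.continuous.tendsto l).comp h

theorem ConvergesIn.map (h : ConvergesIn m u l) (T : V →L[ℝ] W) :
    ConvergesIn m (fun n ↦ T (u n)) (T l) := by
  cases m with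
  | strong => exact (T.continuous.tendsto l).comp h
  | weak => exact convergesIn_weak_iff.2 fun φ ↦ convergesIn_weak_iff.1 h (φ ∘L T)

theorem ConvergesIn.add (h : ConvergesIn m u l) (h' : ConvergesIn m u' l') :
    ConvergesIn m (fun n ↦ u n + u' n) (l + l') := by
  cases m with
  | strong => exact Tendsto.add h h'
  | weak =>
    refine convergesIn_weak_iff.2 fun φ ↦ ?_
    simpa using (convergesIn_weak_iff.1 h φ).add (convergesIn_weak_iff.1 h' φ)

theorem ConvergesIn.sub (h : ConvergesIn m u l) (h' : ConvergesIn m u' l') :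
    ConvergesIn m (fun n ↦ u n - u' n) (l - l') := by
  simpa [sub_eq_add_neg] using h.add (h'.map (-ContinuousLinearMap.id ℝ V))

theorem ConvergesIn.sum {ι : Type*} (s : Finset ι) {u : ι → ℕ → V} {l : ι → V}
    (h : ∀ i ∈ s, ConvergesIn m (u i) (l i)) :
    ConvergesIn m (fun n ↦ ∑ i ∈ s, u i n) (∑ i ∈ s, l i) := by
  classical
  induction s using Finset.induction_on with
  | empty => simpa using ConvergesIn.of_tendsto tendsto_const_nhds
  | insert a s ha ih =>
    simp only [Finset.sum_insert ha]
    exact (h a (Finset.mem_insert_self _ _)).add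
      (ih fun i hi ↦ h i (Finset.mem_insert_of_mem hi))

/-- A sequence converges if it is uniformly close to convergent sequences. -/
theorem ConvergesIn.of_approx (h : ∀ ε > 0, ∃ (w : ℕ → V) (k : V), ConvergesIn m w k ∧
    (∀ᶠ n in atTop, ‖u n - w n‖ ≤ ε) ∧ ‖k - l‖ ≤ ε) : ConvergesIn m u l := by
  cases m with
  | strong =>
    refine Metric.tendsto_atTop'.2 fun ε hε ↦ ?_
    obtain ⟨w, k, hw, hu, hk⟩ := h (ε / 4) (by positivity)
    have hw' : Tendsto w atTop (𝓝 k) := hw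
    have h1 := hu.and (hw'.eventually (Metric.ball_mem_nhds k (show 0 < ε / 4 by positivity)))
    obtain ⟨N, hN⟩ := eventually_atTop.1 h1
    refine ⟨N, fun n hn ↦ ?_⟩
    obtain ⟨a1, a2⟩ := hN n hn.le
    rw [← dist_eq_norm] at a1 hk
    have a3 : dist (w n) k < ε / 4 := a2
    linarith [dist_triangle4 (u n) (w n) k l]
  | weak =>
    refine convergesIn_weak_iff.2 fun φ ↦ Metric.tendsto_atTop'.2 fun ε hε ↦ ?_
    obtain ⟨w, k, hw, hu, hk⟩ := h (ε / (4 * (‖φ‖ + 1))) (by positivity)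
    have hφ : ∀ x y : V, ‖x - y‖ ≤ ε / (4 * (‖φ‖ + 1)) → dist (φ x) (φ y) ≤ ε / 4 := by
      intro x y hxy
      rw [dist_eq_norm, ← map_sub]
      refine (φ.le_opNorm_of_le hxy).trans ?_
      rw [mul_div_assoc', div_le_div_iff₀ (by positivity) (by norm_num)]
      nlinarith [norm_nonneg φ]
    have h1 := hu.and ((convergesIn_weak_iff.1 hw φ).eventually
      (Metric.ball_mem_nhds (φ k) (show 0 < ε / 4 by positivity)))
    obtain ⟨N, hN⟩ := eventually_atTop.1 h1
    refine ⟨N, fun n hn ↦ ?_⟩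
    obtain ⟨a1, a2⟩ := hN n hn.le
    have a3 : dist (φ (w n)) (φ k) < ε / 4 := a2
    linarith [dist_triangle4 (φ (u n)) (φ (w n)) (φ k) (φ l), hφ _ _ a1, hφ _ _ hk]

end Mode

/-! ### Left-point Riemann sums -/

section Riemann

variable {V G : Type*} [NormedAddCommGroup V] [NormedSpace ℝ V]
  [NormedAddCommGroup G] [NormedSpace ℝ G]

/-- The left limits of a càdlàg operator-valued path are approximated by the step functions that
sample the path at the left endpoints of a subdivision. -/
theorem IsCadlag.exists_stepFunction {ξ g : ℝ≥0 → V →L[ℝ] G} (hξ : IsCadlag ξ) {t : ℝ≥0}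
    (hg : ∀ s ∈ Ioc 0 t, g s = leftLim ξ s) {δ : ℝ} (hδ : 0 < δ) :
    ∃ h : StepFunction V G t, h.IsNormClose g δ ∧ (∀ i, h.val i = ξ (h.τ i)) ∧
      ∀ i < h.n, ∀ s ∈ Ico (h.τ i) (h.τ (i + 1)), ‖ξ s - ξ (h.τ i)‖ ≤ δ := by
  obtain ⟨n, τ, h0, hn, hlt, hd⟩ := hξ.exists_subdivision t hδ
  refine ⟨⟨n, τ, h0, hn, hlt, fun i ↦ ξ (τ i)⟩, ?_, fun _ ↦ rfl, fun i hi s hs ↦ ?_⟩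
  · intro i hi s hs
    have hs0 : 0 < s := lt_of_le_of_lt zero_le hs.1
    have hst : s ≤ t := (show s ≤ τ (i + 1) from hs.2).trans
      ((le_of_subdivision hlt (i := i + 1) hi le_rfl).trans_eq hn)
    have := nhdsLT_neBot hs0
    rw [hg s ⟨hs0, hst⟩]
    refine le_of_tendsto ((hξ.tendsto_leftLim hs0).sub_const _).norm ?_
    filter_upwards [Ioo_mem_nhdsLT hs.1] with r hr
    rw [← dist_eq_norm]; exact (hd i hi r ⟨hr.1.le, hr.2.trans_le hs.2⟩).le
  · rw [← dist_eq_norm]; exact (hd i hi s hs).le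

/-- Convergence of left-point Riemann sums to the Stieltjes integral. The contribution `q n i s` of
the `i`-th interval `(t_i, t_{i+1}]` of the `n`-th partition to time `s` is arbitrary, provided that
it vanishes up to time `t_i` and is constant from time `t_{i+1}` on; the total contributions up to
time `s` are to converge to `H s - H 0`. The integrand is frozen at the left endpoints of a fixed
subdivision on whose cells it hardly moves. Only the intervals that straddle a point `s` of this
subdivision need care: for them, either the integrand is continuous at `s`, or the contribution
after time `s` is negligible. -/
theorem convergesIn_riemannSum {m : Mode} {P : ℕ → Partition} {ξ g : ℝ≥0 → V →L[ℝ] G}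
    {H : ℝ≥0 → V} {v : ℝ≥0 → ℝ} (hv : ControlledBy H v) (hH : IsCadlag H) (hξ : IsCadlag ξ)
    (hξP : ApproximatesFromLeft P ξ) {t : ℝ≥0} {q : ℕ → ℕ → ℝ≥0 → V}
    (q_zero : ∀ n i s, s ≤ (P n).pt i → q n i s = 0)
    (q_const : ∀ n i s, (P n).pt (i + 1) ≤ s → q n i s = q n i ((P n).pt (i + 1)))
    {C : ℝ} (q_sum : ∀ n, ∑' i, ‖q n i t‖ ≤ C)
    {C' : ℝ} (q_bdd : ∀ n i, ∀ s ≤ t, ‖q n i s‖ ≤ C')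
    (q_jump : ∀ s ∈ Ioc 0 t, Tendsto (fun n ↦ q n ((P n).index s) s) atTop (𝓝 (jump H s)))
    (q_jump' : ∀ s ∈ Ioc 0 t, jump ξ s ≠ 0 → ∀ r ∈ Icc s t,
      Tendsto (fun n ↦ q n ((P n).index s) r) atTop (𝓝 (jump H s)))
    (q_tendsto : ∀ s ≤ t, ConvergesIn m (fun n ↦ ∑' i, q n i s) (H s - H 0))
    (hg : ∀ s ∈ Ioc 0 t, g s = leftLim ξ s) {I : G} (hI : IsStepLimit g H v t I) :
    ConvergesIn m (fun n ↦ ∑' i, ξ ((P n).pt i) (q n i t)) I := by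
  refine ConvergesIn.of_approx fun ε hε ↦ ?_
  have hvt : 0 ≤ v t - v 0 := sub_nonneg.2 (hv.mono zero_le)
  have hC : 0 ≤ C := (tsum_nonneg fun i ↦ norm_nonneg _).trans (q_sum 0)
  set η : ℝ := ε / (2 * (C + (v t - v 0) + 1)) with hη
  have hη0 : 0 < η := by positivity
  have hη1 : η * (C + (v t - v 0) + 1) = ε / 2 := by
    rw [hη]; field_simp
  obtain ⟨h, hh, hval, hosc⟩ := hξ.exists_stepFunction hg hη0
  set S : ℕ → ℝ≥0 → V := fun n s ↦ ∑' i, q n i s with hS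
  refine ⟨fun n ↦ ∑ j ∈ Finset.range h.n, h.val j (S n (h.τ (j + 1)) - S n (h.τ j)),
    h.integral H, ?_, ?_, ?_⟩
  · refine ConvergesIn.sum _ fun j hj ↦ ?_
    rw [Finset.mem_range] at hj
    have := ((q_tendsto _ (h.τ_le (i := j + 1) hj)).sub (q_tendsto _ (h.τ_le hj.le))).map (h.val j)
    rwa [sub_sub_sub_cancel_right] at this
  swap
  · refine (hI η hη0.le h (hh.isClose H)).trans ?_
    nlinarith [mul_nonneg hη0.le hC]
  -- the contributions of the straddling intervals, after and up to the point of the subdivision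
  set a : ℕ → ℕ → ℝ := fun j n ↦ ‖(ξ ((P n).pt ((P n).index (h.τ j))) - h.val j)
    (q n ((P n).index (h.τ j)) (h.τ (j + 1)) - q n ((P n).index (h.τ j)) (h.τ j))‖ with ha
  set b : ℕ → ℕ → ℝ := fun j n ↦ ‖q n ((P n).index (h.τ (j + 1))) (h.τ (j + 1))‖ with hb
  have hτpos : ∀ j < h.n, 0 < h.τ (j + 1) := fun j hj ↦ lt_of_le_of_lt zero_le (h.τ_lt j hj)
  have a_lim : Tendsto (fun n ↦ ∑ j ∈ Finset.range h.n, a j n) atTop (𝓝 0) := by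
    rw [← Finset.sum_const_zero (s := Finset.range h.n)]
    refine tendsto_finsetSum _ fun j hj ↦ ?_
    rw [Finset.mem_range] at hj
    rcases Nat.eq_zero_or_pos j with rfl | hj0
    · refine tendsto_const_nhds.congr fun n ↦ ?_
      have : (P n).index (h.τ 0) = 0 := by
        rw [h.τ_zero, Partition.index]
        exact Nat.sInf_eq_zero.2 (Or.inl (by simp))
      simp only [ha]
      rw [this, (P n).pt_zero, hval, h.τ_zero, sub_self, zero_apply, norm_zero]
    have hs : h.τ j ∈ Ioc 0 t := by
      refine ⟨?_, h.τ_le hj.le⟩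
      have := hτpos (j - 1) (by omega)
      rwa [Nat.sub_add_cancel hj0] at this
    have hl : Tendsto (fun n ↦ ξ ((P n).pt ((P n).index (h.τ j)))) atTop
        (𝓝 (leftLim ξ (h.τ j))) := by
      refine (hξP _ hs.1).congr fun n ↦ ?_
      rw [Partition.lower_eq hs.1]
    have hle : ∀ n, a j n ≤ ‖ξ ((P n).pt ((P n).index (h.τ j))) - h.val j‖ *
        ‖q n ((P n).index (h.τ j)) (h.τ (j + 1)) - q n ((P n).index (h.τ j)) (h.τ j)‖ :=
      fun n ↦ ContinuousLinearMap.le_opNorm _ _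
    by_cases hjump : jump ξ (h.τ j) = 0
    · have hl' := (hl.sub_const (h.val j)).norm
      rw [hval, show leftLim ξ (h.τ j) = ξ (h.τ j) from (sub_eq_zero.1 hjump).symm, sub_self,
        norm_zero] at hl'
      refine squeeze_zero (fun n ↦ norm_nonneg _) (fun n ↦ (hle n).trans ?_)
        (by simpa using hl'.mul_const (C' + C'))
      rw [hval]
      refine mul_le_mul_of_nonneg_left ((norm_sub_le _ _).trans ?_) (norm_nonneg _)
      exact add_le_add (q_bdd _ _ _ (h.τ_le (i := j + 1) hj)) (q_bdd _ _ _ (h.τ_le hj.le))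
    · have h1 := (q_jump' _ hs hjump (h.τ (j + 1)) ⟨(h.τ_lt j hj).le, h.τ_le (i := j + 1) hj⟩).sub
        (q_jump _ hs)
      have h2 := (hl.sub_const (h.val j)).norm.mul h1.norm
      rw [sub_self, norm_zero, mul_zero] at h2
      exact squeeze_zero (fun n ↦ norm_nonneg _) hle h2
  have b_lim : ∀ᶠ n in atTop, ∑ j ∈ Finset.range h.n, b j n < v t - v 0 + 1 := by
    have h1 : Tendsto (fun n ↦ ∑ j ∈ Finset.range h.n, b j n) atTop
        (𝓝 (∑ j ∈ Finset.range h.n, ‖jump H (h.τ (j + 1))‖)) :=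
      tendsto_finsetSum _ fun j hj ↦ (q_jump _ ⟨hτpos j (Finset.mem_range.1 hj),
        h.τ_le (i := j + 1) (Finset.mem_range.1 hj)⟩).norm
    refine h1.eventually_lt_const ?_
    have h2 : ∑ j ∈ Finset.range h.n, ‖jump H (h.τ (j + 1))‖
        ≤ ∑ j ∈ Finset.range h.n, (v (h.τ (j + 1)) - v (h.τ j)) :=
      Finset.sum_le_sum fun j hj ↦ hv.norm_jump_le hH (h.τ_lt j (Finset.mem_range.1 hj))
    rw [Finset.sum_range_sub fun j ↦ v (h.τ j), h.τ_last, h.τ_zero] at h2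
    linarith
  filter_upwards [b_lim, a_lim.eventually_lt_const (show 0 < ε / 2 by positivity)] with n hbn han
  obtain ⟨N, hN⟩ := (P n).exists_le t
  have hN := hN N le_rfl
  have eS : ∀ s ≤ t, S n s = ∑ i ∈ Finset.range N, q n i s := fun s hs ↦
    Partition.tsum_eq_sum_range (fun i hi ↦ q_zero n i s hi) (hs.trans hN)
  have e1 : ∑' i, ξ ((P n).pt i) (q n i t)
      = ∑ i ∈ Finset.range N, ∑ j ∈ Finset.range h.n,
        ξ ((P n).pt i) (q n i (h.τ (j + 1)) - q n i (h.τ j)) := by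
    rw [Partition.tsum_eq_sum_range (p := P n) (t := t)
      (fun i hi ↦ by rw [q_zero n i t hi, map_zero]) hN]
    refine Finset.sum_congr rfl fun i _ ↦ ?_
    rw [← map_sum, Finset.sum_range_sub fun j ↦ q n i (h.τ j), h.τ_last, h.τ_zero,
      q_zero n i 0 zero_le, sub_zero]
  have e2 : ∑ j ∈ Finset.range h.n, h.val j (S n (h.τ (j + 1)) - S n (h.τ j))
      = ∑ i ∈ Finset.range N, ∑ j ∈ Finset.range h.n,
        h.val j (q n i (h.τ (j + 1)) - q n i (h.τ j)) := by
    rw [Finset.sum_comm]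
    refine Finset.sum_congr rfl fun j hj ↦ ?_
    rw [Finset.mem_range] at hj
    rw [eS _ (h.τ_le (i := j + 1) hj), eS _ (h.τ_le hj.le), ← Finset.sum_sub_distrib, map_sum]
  rw [e1, e2, ← Finset.sum_sub_distrib]
  simp_rw [← Finset.sum_sub_distrib, ← sub_apply]
  have term : ∀ i, ∀ j ∈ Finset.range h.n,
      ‖(ξ ((P n).pt i) - h.val j) (q n i (h.τ (j + 1)) - q n i (h.τ j))‖
        ≤ (if (P n).index (h.τ j) = i then a j n else 0)
          + η * ((if h.τ j ≤ (P n).pt i ∧ (P n).pt i < h.τ (j + 1) then ‖q n i t‖ else 0)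
            + (if (P n).index (h.τ (j + 1)) = i then b j n else 0)) := by
    intro i j hj
    rw [Finset.mem_range] at hj
    have a0 : 0 ≤ if (P n).index (h.τ j) = i then a j n else 0 := by
      split_ifs
      exacts [norm_nonneg _, le_rfl]
    have b0 : 0 ≤ if (P n).index (h.τ (j + 1)) = i then b j n else 0 := by
      split_ifs
      exacts [norm_nonneg _, le_rfl]
    have c0 : 0 ≤ if h.τ j ≤ (P n).pt i ∧ (P n).pt i < h.τ (j + 1) then ‖q n i t‖ else 0 := by
      split_ifs
      exacts [norm_nonneg _, le_rfl]
    have hlt := h.τ_lt j hj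
    rcases le_or_gt (h.τ (j + 1)) ((P n).pt i) with h1 | h1
    · rw [q_zero n i _ h1, q_zero n i _ (hlt.le.trans h1), sub_zero, map_zero, norm_zero]
      positivity
    rcases le_or_gt (h.τ j) ((P n).pt i) with h2 | h2
    · rw [q_zero n i _ h2, sub_zero]
      have h3 : ‖(ξ ((P n).pt i) - h.val j) (q n i (h.τ (j + 1)))‖
          ≤ η * ‖q n i (h.τ (j + 1))‖ :=
        ContinuousLinearMap.le_of_opNorm_le _ (by rw [hval]; exact hosc j hj _ ⟨h2, h1⟩) _
      refine h3.trans (le_add_of_nonneg_of_le a0 (mul_le_mul_of_nonneg_left ?_ hη0.le))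
      rcases le_or_gt (h.τ (j + 1)) ((P n).pt (i + 1)) with h4 | h4
      · have : (P n).index (h.τ (j + 1)) = i := Partition.index_eq h1 h4
        refine le_add_of_nonneg_of_le c0 ?_
        rw [if_pos this]
        simp only [hb]
        rw [this]
      · rw [if_pos ⟨h2, h1⟩, q_const n i _ h4.le,
          q_const n i t (h4.le.trans (h.τ_le (i := j + 1) hj))]
        exact le_add_of_nonneg_right b0
    · rcases le_or_gt (h.τ j) ((P n).pt (i + 1)) with h4 | h4
      · have : (P n).index (h.τ j) = i := Partition.index_eq h2 h4
        refine le_add_of_le_of_nonneg ?_ (by positivity)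
        rw [if_pos this]
        simp only [ha]
        rw [this]
      · rw [q_const n i _ h4.le, q_const n i _ (h4.le.trans hlt.le), sub_self, map_zero, norm_zero]
        positivity
  refine (norm_sum_le_of_le _ fun i _ ↦ norm_sum_le_of_le _ (term i)).trans ?_
  simp_rw [Finset.sum_add_distrib, ← Finset.mul_sum, Finset.sum_add_distrib]
  have s1 : ∑ i ∈ Finset.range N, ∑ j ∈ Finset.range h.n,
      (if (P n).index (h.τ j) = i then a j n else 0) ≤ ∑ j ∈ Finset.range h.n, a j n := by
    rw [Finset.sum_comm]
    refine Finset.sum_le_sum fun j _ ↦ ?_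
    rw [Finset.sum_ite_eq]
    split_ifs
    exacts [le_rfl, norm_nonneg _]
  have s2 : ∑ i ∈ Finset.range N, ∑ j ∈ Finset.range h.n,
      (if (P n).index (h.τ (j + 1)) = i then b j n else 0) ≤ ∑ j ∈ Finset.range h.n, b j n := by
    rw [Finset.sum_comm]
    refine Finset.sum_le_sum fun j _ ↦ ?_
    rw [Finset.sum_ite_eq]
    split_ifs
    exacts [le_rfl, norm_nonneg _]
  have s3 : ∑ i ∈ Finset.range N, ∑ j ∈ Finset.range h.n,
      (if h.τ j ≤ (P n).pt i ∧ (P n).pt i < h.τ (j + 1) then ‖q n i t‖ else 0) ≤ C := by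
    have := Partition.tsum_eq_sum_range (p := P n) (t := t) (q := fun i ↦ ‖q n i t‖)
      (fun i hi ↦ by rw [q_zero n i t hi, norm_zero]) hN
    refine le_trans (Finset.sum_le_sum fun i _ ↦ ?_) (this ▸ q_sum n)
    -- the left endpoint `t_i` lies in at most one cell of the subdivision
    rw [← Finset.sum_filter]
    refine (Finset.sum_le_card_nsmul _ _ _ fun _ _ ↦ le_rfl).trans ?_
    rw [nsmul_eq_mul]
    refine mul_le_of_le_one_left (norm_nonneg _) ?_
    rw [Nat.cast_le_one, Finset.card_le_one]
    intro j hj k hk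
    simp only [Finset.mem_filter, Finset.mem_range] at hj hk
    by_contra hne
    rcases Nat.lt_or_gt_of_ne hne with hlt | hlt
    · exact absurd (hj.2.2.trans_le (le_of_subdivision h.τ_lt hlt hk.1.le)) (not_lt.2 hk.2.1)
    · exact absurd (hk.2.2.trans_le (le_of_subdivision h.τ_lt hlt hj.1.le)) (not_lt.2 hj.2.1)
  have s4 := mul_le_mul_of_nonneg_left (add_le_add s3 (s2.trans hbn.le)) hη0.le
  linarith

end Riemann

/-! ### The second order Taylor formula -/

section Taylor

variable {E F G : Type*} [NormedAddCommGroup E] [NormedSpace ℝ E] [NormedAddCommGroup F]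
  [NormedSpace ℝ F] [NormedAddCommGroup G] [NormedSpace ℝ G]

theorem ReasonableCrossnorm.norm_tmul_le (α : ReasonableCrossnorm E F) (u : E) (v : F) :
    ‖α.tmul u v‖ ≤ ‖u‖ * ‖v‖ := by
  have h : α.tmul u v = ((α.algTmul u v : α.Alg) : α.Completed) := rfl
  rw [h, UniformSpace.Completion.norm_coe]
  exact α.map_tmul_le u v

/-- A reasonable crossnorm is multiplicative on elementary tensors: the lower bound is the dual
condition, applied to norming functionals. -/
theorem ReasonableCrossnorm.norm_tmul (α : ReasonableCrossnorm E F) (u : E) (v : F) :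
    ‖α.tmul u v‖ = ‖u‖ * ‖v‖ := by
  refine le_antisymm (α.norm_tmul_le u v) ?_
  obtain ⟨φ, hφ, hu⟩ := exists_dual_vector'' ℝ u
  obtain ⟨ψ, hψ, hv⟩ := exists_dual_vector'' ℝ v
  have h : α.tmul u v = ((α.algTmul u v : α.Alg) : α.Completed) := rfl
  rw [h, UniformSpace.Completion.norm_coe]
  have h1 := α.dual_le φ ψ (u ⊗ₜ[ℝ] v)
  rw [TensorProduct.dualDistrib_apply] at h1
  change |φ u * ψ v| ≤ _ at h1
  rw [hu, hv] at h1
  have h2 : ‖φ‖ * ‖ψ‖ ≤ 1 := mul_le_one₀ hφ (norm_nonneg _) hψ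
  have h3 : (0 : ℝ) ≤ α.toFun (u ⊗ₜ[ℝ] v) := apply_nonneg α.toSeminorm _
  calc ‖u‖ * ‖v‖ ≤ |((‖u‖ : ℝ) * (‖v‖ : ℝ))| := le_abs_self _
    _ ≤ ‖φ‖ * ‖ψ‖ * α.toFun (u ⊗ₜ[ℝ] v) := h1
    _ ≤ α.toFun (u ⊗ₜ[ℝ] v) := mul_le_of_le_one_left h3 h2

theorem norm_smul_le_of_mem_Icc {θ : ℝ} (hθ : θ ∈ Icc (0 : ℝ) 1) (v : E) : ‖θ • v‖ ≤ ‖v‖ := by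
  rw [norm_smul, Real.norm_of_nonneg hθ.1]
  exact mul_le_of_le_one_left (norm_nonneg _) hθ.2

theorem hasDerivAt_line {f : E → G} {L : E → E →L[ℝ] G} (hf : ∀ x, HasGateauxDerivAt f (L x) x)
    (x h : E) (θ : ℝ) : HasDerivAt (fun s : ℝ ↦ f (x + s • h)) (L (x + θ • h) h) θ := by
  have h1 : HasDerivAt (fun s : ℝ ↦ f (x + θ • h + s • h)) (L (x + θ • h) h) (θ - θ) := by
    rw [sub_self]; exact hf (x + θ • h) h
  refine (h1.comp_sub_const θ θ).congr_of_eventuallyEq (Eventually.of_forall fun s ↦ ?_)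
  change f (x + s • h) = f (x + θ • h + (s - θ) • h)
  rw [add_assoc, ← add_smul, add_sub_cancel]

/-- First order Taylor estimate for Gâteaux derivatives. -/
theorem norm_sub_sub_le_of_hasGateauxDerivAt {f : E → G} {L : E → E →L[ℝ] G}
    (hf : ∀ x, HasGateauxDerivAt f (L x) x) (x h : E) (T : E →L[ℝ] G) {η : ℝ}
    (hη : ∀ θ ∈ Icc (0 : ℝ) 1, ‖L (x + θ • h) - T‖ ≤ η) :
    ‖f (x + h) - f x - T h‖ ≤ η * ‖h‖ := by
  have h1 : ∀ θ : ℝ, HasDerivAt (fun s : ℝ ↦ f (x + s • h) - s • T h)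
      ((L (x + θ • h) - T) h) θ := by
    intro θ
    have := (hasDerivAt_line hf x h θ).fun_sub ((hasDerivAt_id θ).smul_const (T h))
    simpa using this
  have h2 := norm_image_sub_le_of_norm_deriv_le_segment_01' (C := η * ‖h‖)
    (fun θ _ ↦ (h1 θ).hasDerivWithinAt)
    fun θ hθ ↦ ContinuousLinearMap.le_of_opNorm_le _ (hη θ ⟨hθ.1, hθ.2.le⟩) h
  simpa [sub_right_comm] using h2

/-- Second order Taylor estimate for Gâteaux derivatives. -/
theorem norm_sub_sub_sub_le_of_hasGateauxDerivAt {f : E → G} {L : E → E →L[ℝ] G}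
    {M : E → E →L[ℝ] E →L[ℝ] G} (hf : ∀ x, HasGateauxDerivAt f (L x) x)
    (hL : ∀ x, HasGateauxDerivAt L (M x) x) (x h : E) (T : G) {η : ℝ}
    (hη : ∀ θ ∈ Icc (0 : ℝ) 1, ‖M (x + θ • h) h h - T‖ ≤ η) :
    ‖f (x + h) - f x - L x h - (1 / 2 : ℝ) • T‖ ≤ η := by
  have h1 : ∀ θ : ℝ, HasDerivAt (fun s : ℝ ↦ L (x + s • h) h - s • T)
      (M (x + θ • h) h h - T) θ := by
    intro θ
    have := ((hasDerivAt_line hL x h θ).clm_apply (hasDerivAt_const θ h)).fun_sub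
      ((hasDerivAt_id θ).smul_const T)
    simpa using this
  have hη0 : 0 ≤ η := (norm_nonneg _).trans (hη 0 ⟨le_rfl, zero_le_one⟩)
  have h2 : ∀ θ ∈ Icc (0 : ℝ) 1, ‖L (x + θ • h) h - L x h - θ • T‖ ≤ η := by
    intro θ hθ
    have := norm_image_sub_le_of_norm_deriv_le_segment' (a := 0) (b := 1) (C := η)
      (fun θ _ ↦ (h1 θ).hasDerivWithinAt) (fun θ hθ ↦ hη θ ⟨hθ.1, hθ.2.le⟩) θ hθ
    rw [zero_smul, zero_smul, add_zero, sub_zero, sub_zero, sub_right_comm] at this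
    exact this.trans (mul_le_of_le_one_right hη0 hθ.2)
  have h3 : ∀ θ : ℝ, HasDerivAt (fun s : ℝ ↦ f (x + s • h) - s • L x h - (s ^ 2 / 2) • T)
      (L (x + θ • h) h - L x h - θ • T) θ := by
    intro θ
    have := ((hasDerivAt_line hf x h θ).fun_sub ((hasDerivAt_id θ).smul_const (L x h))).fun_sub
      ((((hasDerivAt_id θ).pow 2).div_const 2).smul_const T)
    simpa using this
  have h4 := norm_image_sub_le_of_norm_deriv_le_segment_01' (C := η)
    (fun θ _ ↦ (h3 θ).hasDerivWithinAt) fun θ hθ ↦ h2 θ ⟨hθ.1, hθ.2.le⟩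
  have e : f (x + h) - f x - L x h - (1 / 2 : ℝ) • T
      = f (x + (1 : ℝ) • h) - (1 : ℝ) • L x h - ((1 : ℝ) ^ 2 / 2) • T
        - (f (x + (0 : ℝ) • h) - (0 : ℝ) • L x h - ((0 : ℝ) ^ 2 / 2) • T) := by
    simp only [one_smul, zero_smul, one_pow, add_zero, sub_zero, ne_eq, OfNat.ofNat_ne_zero,
      not_false_eq_true, zero_pow, zero_div]
    abel
  rw [e]
  exact h4

/-- The remainder of the Taylor expansion of `f` at `q`, of first order in the first variable and of
second order in the second one. -/
noncomputable def taylorRem (α : ReasonableCrossnorm E E) (f : F × E → G)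
    (Da : F × E → F →L[ℝ] G) (Dx : F × E → E →L[ℝ] G) (Dα : F × E → α.Completed →L[ℝ] G)
    (q q' : F × E) : G :=
  f q' - f q - Da q (q'.1 - q.1) - Dx q (q'.2 - q.2)
    - (1 / 2 : ℝ) • Dα q (α.tmul (q'.2 - q.2) (q'.2 - q.2))

variable {α : ReasonableCrossnorm E E} {f : F × E → G}
  {Da : F × E → F →L[ℝ] G} {Dx : F × E → E →L[ℝ] G} {Dxx : F × E → E →L[ℝ] E →L[ℝ] G}
  {Dα : F × E → α.Completed →L[ℝ] G}

theorem norm_taylorRem_le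
    (hDa : ∀ a x, HasGateauxDerivAt (fun b ↦ f (b, x)) (Da (a, x)) a)
    (hDx : ∀ a x, HasGateauxDerivAt (fun y ↦ f (a, y)) (Dx (a, x)) x)
    (hDxx : ∀ a x, HasGateauxDerivAt (fun y ↦ Dx (a, y)) (Dxx (a, x)) x)
    (hDα : ∀ p u v, Dα p (α.tmul u v) = Dxx p u v) (q q' : F × E) {η : ℝ}
    (h1 : ∀ p, ‖p - q‖ ≤ ‖q' - q‖ → ‖Da p - Da q‖ ≤ η)
    (h2 : ∀ p, ‖p - q‖ ≤ ‖q' - q‖ → ‖Dα p - Dα q‖ ≤ η) :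
    ‖taylorRem α f Da Dx Dα q q'‖ ≤ η * (‖q'.1 - q.1‖ + ‖q'.2 - q.2‖ ^ 2) := by
  obtain ⟨a, x⟩ := q
  obtain ⟨a', x'⟩ := q'
  have hq : ‖((a', x') : F × E) - (a, x)‖ = max ‖a' - a‖ ‖x' - x‖ := rfl
  have b1 := norm_sub_sub_le_of_hasGateauxDerivAt (fun b ↦ hDa b x') a (a' - a) (Da (a, x))
    (η := η) fun θ hθ ↦ h1 _ (by
      rw [hq]
      change max ‖a + θ • (a' - a) - a‖ ‖x' - x‖ ≤ _
      rw [add_sub_cancel_left]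
      exact max_le_max_right _ (norm_smul_le_of_mem_Icc hθ (a' - a)))
  have b2 := norm_sub_sub_sub_le_of_hasGateauxDerivAt (hDx a) (hDxx a) x (x' - x)
    (Dα (a, x) (α.tmul (x' - x) (x' - x))) (η := η * ‖x' - x‖ ^ 2) fun θ hθ ↦ by
      rw [← hDα, ← sub_apply]
      refine (ContinuousLinearMap.le_of_opNorm_le _ (h2 _ ?_) _).trans_eq ?_
      · rw [hq]
        change max ‖a - a‖ ‖x + θ • (x' - x) - x‖ ≤ _
        rw [add_sub_cancel_left, sub_self, norm_zero]
        exact max_le_max (norm_nonneg _) (norm_smul_le_of_mem_Icc hθ (x' - x))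
      · rw [α.norm_tmul, sq]
  rw [add_sub_cancel] at b1 b2
  have e : taylorRem α f Da Dx Dα (a, x) (a', x')
      = (f (a', x') - f (a, x') - Da (a, x) (a' - a))
        + (f (a, x') - f (a, x) - Dx (a, x) (x' - x)
          - (1 / 2 : ℝ) • Dα (a, x) (α.tmul (x' - x) (x' - x))) := by
    simp only [taylorRem]; abel
  rw [e]
  refine (norm_add_le_of_le b1 b2).trans_eq ?_
  ring

/-- Near a compact set, the Taylor remainder is negligible with respect to
`‖δa‖ + ‖δx‖²`. -/
theorem exists_norm_taylorRem_le
    (hDa : ∀ a x, HasGateauxDerivAt (fun b ↦ f (b, x)) (Da (a, x)) a)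
    (hDx : ∀ a x, HasGateauxDerivAt (fun y ↦ f (a, y)) (Dx (a, x)) x)
    (hDxx : ∀ a x, HasGateauxDerivAt (fun y ↦ Dx (a, y)) (Dxx (a, x)) x)
    (hDα : ∀ p u v, Dα p (α.tmul u v) = Dxx p u v) (cDa : Continuous Da) (cDα : Continuous Dα)
    {K : Set (F × E)} (hK : IsCompact K) {η : ℝ} (hη : 0 < η) :
    ∃ δ > 0, ∀ q ∈ K, ∀ q', ‖q' - q‖ < δ →
      ‖taylorRem α f Da Dx Dα q q'‖ ≤ η * (‖q'.1 - q.1‖ + ‖q'.2 - q.2‖ ^ 2) := by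
  have u1 := hK.uniformContinuousAt_of_continuousAt Da (fun a _ ↦ cDa.continuousAt)
    (Metric.dist_mem_uniformity hη)
  have u2 := hK.uniformContinuousAt_of_continuousAt Dα (fun a _ ↦ cDα.continuousAt)
    (Metric.dist_mem_uniformity hη)
  obtain ⟨δ, hδ, hd⟩ := Metric.mem_uniformity_dist.1 (inter_mem u1 u2)
  refine ⟨δ, hδ, fun q hq q' hqq' ↦ norm_taylorRem_le hDa hDx hDxx hDα q q' ?_ ?_⟩
  · intro p hp
    have : dist (Da q) (Da p) < η := (hd (by
      rw [dist_comm, dist_eq_norm]; exact hp.trans_lt hqq')).1 hq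
    rw [← dist_eq_norm, dist_comm]; exact this.le
  · intro p hp
    have : dist (Dα q) (Dα p) < η := (hd (by
      rw [dist_comm, dist_eq_norm]; exact hp.trans_lt hqq')).2 hq
    rw [← dist_eq_norm, dist_comm]; exact this.le

/-- Joint continuity of `f` follows from its Taylor expansion. -/
theorem continuous_of_hasGateauxDerivAt
    (hDa : ∀ a x, HasGateauxDerivAt (fun b ↦ f (b, x)) (Da (a, x)) a)
    (hDx : ∀ a x, HasGateauxDerivAt (fun y ↦ f (a, y)) (Dx (a, x)) x)
    (hDxx : ∀ a x, HasGateauxDerivAt (fun y ↦ Dx (a, y)) (Dxx (a, x)) x)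
    (hDα : ∀ p u v, Dα p (α.tmul u v) = Dxx p u v) (cDa : Continuous Da) (cDα : Continuous Dα) :
    Continuous f := by
  refine continuous_iff_continuousAt.2 fun q ↦ ?_
  obtain ⟨δ, hδ, hd⟩ := exists_norm_taylorRem_le hDa hDx hDxx hDα cDa cDα
    (isCompact_singleton (x := q)) one_pos
  have l1 : Tendsto (fun q' ↦ taylorRem α f Da Dx Dα q q') (𝓝 q) (𝓝 0) := by
    have l2 : Tendsto (fun q' : F × E ↦ 1 * (‖q'.1 - q.1‖ + ‖q'.2 - q.2‖ ^ 2)) (𝓝 q) (𝓝 0) := by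
      have : Continuous fun q' : F × E ↦ 1 * (‖q'.1 - q.1‖ + ‖q'.2 - q.2‖ ^ 2) := by fun_prop
      simpa using this.tendsto q
    refine squeeze_zero_norm' ?_ l2
    filter_upwards [Metric.ball_mem_nhds q hδ] with q' hq'
    exact hd q rfl q' (by rwa [← dist_eq_norm])
  have l3 : Tendsto (fun q' : F × E ↦ f q + Da q (q'.1 - q.1) + Dx q (q'.2 - q.2)
      + (1 / 2 : ℝ) • Dα q (α.tmul (q'.2 - q.2) (q'.2 - q.2))) (𝓝 q) (𝓝 (f q)) := by
    have : Continuous fun q' : F × E ↦ f q + Da q (q'.1 - q.1) + Dx q (q'.2 - q.2)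
      + (1 / 2 : ℝ) • Dα q (α.tmul (q'.2 - q.2) (q'.2 - q.2)) := by fun_prop
    simpa using this.tendsto q
  have l4 := l1.add l3
  rw [zero_add] at l4
  refine l4.congr fun q' ↦ ?_
  simp only [taylorRem]
  abel

theorem continuous_taylorRem (cf : Continuous f) (cDa : Continuous Da) (cDx : Continuous Dx)
    (cDα : Continuous Dα) :
    Continuous fun z : (F × E) × (F × E) ↦ taylorRem α f Da Dx Dα z.1 z.2 := by
  unfold taylorRem
  fun_prop

end Taylor

/-! ### Sums of remainders over the intervals of a partition -/

section Remainder

variable {V G : Type*} [NormedAddCommGroup V] [NormedAddCommGroup G]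

/-- Over an interval without big jumps, the increment of a path is at most the oscillation of the
path reduced by its big jumps. The left endpoint, which the interval does not contain, is reached
by right continuity. -/
theorem enorm_incr_le_osc {p : Partition} {Z : ℝ≥0 → V} (hZ : IsCadlag Z) {t : ℝ≥0} {ε : ℝ} {i : ℕ}
    (hi : Ioc (p.pt i) (p.pt (i + 1)) ∩ Iic t ∩ bigJumps Z ε = ∅) :
    ‖p.incr Z t i‖ₑ ≤ p.osc (fun s ↦ Z s - bigJumpPart Z ε s) t := by
  rcases le_or_gt t (p.pt i) with h | h
  · rw [Partition.incr_eq_zero Z h]; simp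
  set y := min (p.pt (i + 1)) t with hy
  have hlt : p.pt i < y := lt_min (p.strictMono (Nat.lt_succ_self i)) h
  have hJ : ∀ u ∈ Ioc (p.pt i) y, bigJumpPart Z ε u = bigJumpPart Z ε y := by
    intro u hu
    have hset : Ioc 0 u ∩ bigJumps Z ε = Ioc 0 y ∩ bigJumps Z ε := by
      ext s
      refine ⟨fun hs ↦ ⟨⟨hs.1.1, hs.1.2.trans hu.2⟩, hs.2⟩, fun hs ↦ ⟨⟨hs.1.1, ?_⟩, hs.2⟩⟩
      by_contra hcon
      have : s ∈ Ioc (p.pt i) (p.pt (i + 1)) ∩ Iic t ∩ bigJumps Z ε :=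
        ⟨⟨⟨hu.1.trans (not_le.1 hcon), hs.1.2.trans (min_le_left _ _)⟩,
          hs.1.2.trans (min_le_right _ _)⟩, hs.2⟩
      rw [hi] at this
      exact this
    simp only [bigJumpPart, hset]
  have hb : ∀ u ∈ Ioc (p.pt i) y, ‖Z y - Z u‖ₑ ≤ p.osc (fun s ↦ Z s - bigJumpPart Z ε s) t := by
    intro u hu
    have hmem : ∀ r ∈ Ioc (p.pt i) y, r ∈ Ioc (p.pt i) (p.pt (i + 1)) ∩ Iic t := fun r hr ↦
      ⟨⟨hr.1, hr.2.trans (min_le_left _ _)⟩, hr.2.trans (min_le_right _ _)⟩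
    have h1 := Metric.edist_le_ediam_of_mem
      (mem_image_of_mem (fun s ↦ Z s - bigJumpPart Z ε s) (hmem y ⟨hlt, le_rfl⟩))
      (mem_image_of_mem (fun s ↦ Z s - bigJumpPart Z ε s) (hmem u hu))
    rw [hJ u hu, edist_sub_right, edist_eq_enorm_sub] at h1
    exact h1.trans (le_iSup (fun i : ℕ ↦ Metric.ediam ((fun s ↦ Z s - bigJumpPart Z ε s) ''
      (Ioc (p.pt i) (p.pt (i + 1)) ∩ Iic t))) i)
  have e : p.incr Z t i = Z y - Z (p.pt i) := by
    rw [Partition.incr, min_eq_left h.le]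
  rw [e]
  have hne : (𝓝[>] (p.pt i)).NeBot := nhdsGT_neBot_of_exists_gt ⟨y, hlt⟩
  refine le_of_tendsto ((hZ.tendsto_right (p.pt i)).const_sub (Z y)).enorm ?_
  filter_upwards [Ioc_mem_nhdsGT hlt] with u hu
  exact hb u hu

/-- If `r x y` is continuous and negligible with respect to `c (y - x)` for `y` near `x`, then
the sum of `r` over the increments of a path along a sequence of partitions that satisfies
Condition (C) converges to the sum of `r` over the jumps of the path: by (C1) and (C2), each of the
finitely many big jumps is picked up by one interval, and by (C3) the other increments are
uniformly small. -/
theorem tendsto_tsum_remainder [CompleteSpace V] [NormedSpace ℝ G] [CompleteSpace G] {P : ℕ → Partition}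
    {Z : ℝ≥0 → V} (hZ : IsCadlag Z) (hC : ConditionC P Z) (hleft : ApproximatesFromLeft P Z)
    (t : ℝ≥0) {r : V → V → G} (hr : Continuous fun z : V × V ↦ r z.1 z.2) (hr0 : ∀ x, r x x = 0)
    {c : V → ℝ} (hc : ∀ x, 0 ≤ c x) (hc0 : c 0 = 0)
    (hrc : ∀ K : Set V, IsCompact K → ∀ η > 0, ∃ δ > 0, ∀ x ∈ K, ∀ y, ‖y - x‖ < δ →
      ‖r x y‖ ≤ η * c (y - x))
    {C : ℝ} (hcsum : ∀ n, ∑' i, c ((P n).incr Z t i) ≤ C)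
    (hcj : Summable fun s : Ioc 0 t ↦ c (jump Z s)) :
    Summable (fun s : Ioc 0 t ↦ r (leftLim Z s) (Z s)) ∧
      Tendsto (fun n ↦ ∑' i, r (Z (min ((P n).pt i) t)) (Z (min ((P n).pt (i + 1)) t))) atTop
        (𝓝 (∑' s : Ioc 0 t, r (leftLim Z s) (Z s))) := by
  have hK := hZ.isCompact_closure t
  have hfin : ∀ ε > 0, {s : Ioc 0 t | (s : ℝ≥0) ∈ bigJumps Z ε}.Finite := fun ε hε ↦
    ((hZ.finite_bigJumps t hε).preimage Subtype.val_injective.injOn).subset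
      fun s hs ↦ ⟨s.2, hs⟩
  have hsum : Summable (fun s : Ioc 0 t ↦ r (leftLim Z s) (Z s)) := by
    obtain ⟨δ, hδ, hd⟩ := hrc _ hK 1 one_pos
    refine Summable.of_norm_bounded_eventually hcj ?_
    refine (hfin δ hδ).subset fun s hs ↦ ?_
    by_contra hcon
    refine hs ?_
    have := hd _ (hZ.leftLim_mem_closure s.2.1 s.2.2) (Z s) (not_le.1 hcon)
    rwa [one_mul] at this
  refine ⟨hsum, ?_⟩
  have hCn : 0 ≤ C := (tsum_nonneg fun i ↦ hc _).trans (hcsum 0)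
  set C' : ℝ := ∑' s : Ioc 0 t, c (jump Z s) with hC'
  have hC'n : 0 ≤ C' := tsum_nonneg fun s ↦ hc _
  change ConvergesIn .strong _ _
  refine ConvergesIn.of_approx fun ε hε ↦ ?_
  set η : ℝ := ε / (C + C' + 1) with hη
  have hη0 : 0 < η := by positivity
  have hη1 : η * (C + C' + 1) = ε := by rw [hη]; field_simp
  obtain ⟨δ, hδ, hd⟩ := hrc _ hK η hη0
  have l1 := eventually_lt_of_limsup_lt ((hC.controls_osc t).trans_lt (ENNReal.ofReal_pos.2 hδ))
  -- jumps of size at least `e` count as big: by (C3) the reduced path then oscillates by less than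
  -- `δ` over the intervals of the partitions, and by `e < δ` the remaining jumps are smaller than `δ`
  obtain ⟨e, he, he0, heδ⟩ := (l1.and (Ioo_mem_nhdsGT hδ)).exists
  have l2 := eventually_lt_of_limsup_lt he
  obtain ⟨N', hN'⟩ := hC.separates t e he0
  set T : Finset (Ioc (0 : ℝ≥0) t) := (hfin e he0).toFinset with hT
  have memT : ∀ s : Ioc (0 : ℝ≥0) t, s ∈ T ↔ e ≤ ‖jump Z s‖ := fun s ↦ by
    rw [hT, Set.Finite.mem_toFinset]; rfl
  have hlow : ∀ n, ∀ s : Ioc (0 : ℝ≥0) t, min ((P n).lower s) t = (P n).lower s := fun n s ↦ by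
    rw [Partition.lower_eq s.2.1]
    exact min_eq_left (((P n).pt_index_lt s.2.1).le.trans s.2.2)
  refine ⟨fun n ↦ ∑ s ∈ T, r (Z ((P n).lower s)) (Z (min ((P n).upper s) t)),
    ∑ s ∈ T, r (leftLim Z s) (Z s), ?_, ?_, ?_⟩
  · refine tendsto_finsetSum _ fun s hs ↦ ?_
    have hne : jump Z s ≠ 0 := norm_pos_iff.1 (he0.trans_le ((memT s).1 hs))
    have h1 := hleft s s.2.1
    have h2 := (hC.recovers_jumps s hne t s.2.2).add h1
    simp only [hlow, sub_add_cancel, jump] at h2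
    exact (hr.tendsto (leftLim Z s, Z s)).comp (h1.prodMk_nhds h2)
  · filter_upwards [l2, eventually_ge_atTop N'] with n hn hnN
    obtain ⟨N, hN⟩ := (P n).exists_le t
    have hN := hN N le_rfl
    set R : ℕ → G := fun i ↦ r (Z (min ((P n).pt i) t)) (Z (min ((P n).pt (i + 1)) t)) with hR
    have hR0 : ∀ i, t ≤ (P n).pt i → R i = 0 := fun i hi ↦ by
      have hi' : t ≤ (P n).pt (i + 1) := hi.trans ((P n).strictMono (Nat.lt_succ_self i)).le
      simp only [hR, min_eq_right hi, min_eq_right hi', hr0]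
    have hinj : Set.InjOn (fun s : Ioc (0 : ℝ≥0) t ↦ (P n).index s) T := by
      intro s hs s' hs' hss
      have m1 : ∀ s ∈ T, (s : ℝ≥0) ∈ Ioc ((P n).pt ((P n).index s)) ((P n).pt ((P n).index s + 1))
          ∩ Iic t ∩ bigJumps Z e := fun s hs ↦
        ⟨⟨⟨(P n).pt_index_lt s.2.1, (P n).le_pt_index s⟩, s.2.2⟩, (memT s).1 hs⟩
      have m2 := m1 s' hs'
      have hss' : (P n).index s = (P n).index s' := hss
      rw [← hss'] at m2
      exact Subtype.ext (hN' n hnN _ (m1 s hs) m2)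
    have e1 : ∑ s ∈ T, r (Z ((P n).lower s)) (Z (min ((P n).upper s) t))
        = ∑ i ∈ T.image fun s : Ioc (0 : ℝ≥0) t ↦ (P n).index s, R i := by
      rw [Finset.sum_image hinj]
      refine Finset.sum_congr rfl fun s _ ↦ ?_
      simp only [hR]
      rw [← Partition.lower_eq s.2.1, ← Partition.upper_eq s.2.1, hlow]
    have hsub : (T.image fun s : Ioc (0 : ℝ≥0) t ↦ (P n).index s) ⊆ Finset.range N := by
      intro i hi
      obtain ⟨s, _, rfl⟩ := Finset.mem_image.1 hi
      exact Finset.mem_range.2 ((P n).strictMono.lt_iff_lt.1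
        (((P n).pt_index_lt s.2.1).trans_le (le_trans s.2.2 hN)))
    rw [Partition.tsum_eq_sum_range hR0 hN, e1, ← Finset.sum_sdiff hsub, add_sub_cancel_right]
    have e2 : ∑ i ∈ Finset.range N, c ((P n).incr Z t i) ≤ C := by
      rw [← Partition.tsum_eq_sum_range (p := P n) (t := t) (fun i hi ↦ by
        rw [Partition.incr_eq_zero Z hi, hc0]) hN]
      exact hcsum n
    refine (norm_sum_le_of_le _ (f := fun i ↦ R i) (n := fun i ↦ η * c ((P n).incr Z t i))
      fun i hi ↦ ?_).trans ?_
    · have hi' := (Finset.mem_sdiff.1 hi).2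
      have hempty : Ioc ((P n).pt i) ((P n).pt (i + 1)) ∩ Iic t ∩ bigJumps Z e = ∅ := by
        refine eq_empty_of_forall_notMem fun s hs ↦ hi' ?_
        refine Finset.mem_image.2 ⟨⟨s, lt_of_le_of_lt zero_le hs.1.1.1, hs.1.2⟩,
          (memT _).2 hs.2, ?_⟩
        exact Partition.index_eq hs.1.1.1 hs.1.1.2
      have h1 := (enorm_incr_le_osc hZ hempty).trans_lt hn
      rw [← ofReal_norm, ENNReal.ofReal_lt_ofReal_iff hδ] at h1
      exact hd _ (subset_closure (mem_image_of_mem _ (mem_Iic.2 (min_le_right _ _)))) _ h1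
    · rw [← Finset.mul_sum]
      have h1 : ∑ i ∈ Finset.range N \ T.image (fun s : Ioc (0 : ℝ≥0) t ↦ (P n).index s),
          c ((P n).incr Z t i) ≤ C :=
        (Finset.sum_le_sum_of_subset_of_nonneg Finset.sdiff_subset fun i _ _ ↦ hc _).trans e2
      nlinarith [mul_le_mul_of_nonneg_left h1 hη0.le, mul_nonneg hη0.le hC'n]
  · rw [norm_sub_rev, ← hsum.sum_add_tsum_compl (s := T), add_sub_cancel_left]
    have h1 : Summable fun s : ((T : Set (Ioc (0 : ℝ≥0) t))ᶜ : Set _) ↦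
        η * c (jump Z (s : Ioc (0 : ℝ≥0) t)) := (hcj.mul_left η).subtype _
    have h2 : ‖∑' s : ((T : Set (Ioc (0 : ℝ≥0) t))ᶜ : Set _),
        r (leftLim Z (s : Ioc (0 : ℝ≥0) t)) (Z (s : Ioc (0 : ℝ≥0) t))‖
        ≤ ∑' s : ((T : Set (Ioc (0 : ℝ≥0) t))ᶜ : Set _), η * c (jump Z (s : Ioc (0 : ℝ≥0) t)) := by
      refine tsum_of_norm_bounded h1.hasSum fun s ↦ ?_
      have hs : (s : Ioc (0 : ℝ≥0) t) ∉ T := s.2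
      rw [memT, not_le] at hs
      exact hd _ (hZ.leftLim_mem_closure s.1.2.1 s.1.2.2) _ (hs.trans heδ)
    refine h2.trans ((Summable.tsum_subtype_le (fun s : Ioc (0 : ℝ≥0) t ↦ η * c (jump Z s)) _
      (fun s ↦ mul_nonneg hη0.le (hc _)) (hcj.mul_left η)).trans ?_)
    rw [tsum_mul_left]
    nlinarith [mul_nonneg hη0.le hCn]

end Remainder

/-! ### Increments along a partition -/

section Incr

variable {V : Type*} [NormedAddCommGroup V] {p : Partition}

theorem Partition.incr_eq_of_le (X : ℝ≥0 → V) {s : ℝ≥0} {i : ℕ} (h : p.pt (i + 1) ≤ s) :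
    p.incr X s i = p.incr X (p.pt (i + 1)) i := by
  have h' := (p.strictMono (Nat.lt_succ_self i)).le
  simp only [incr, min_eq_left h, min_eq_left h', min_eq_left (h'.trans h), min_self]

theorem Partition.incr_index (X : ℝ≥0 → V) {s : ℝ≥0} (hs : 0 < s) (r : ℝ≥0) :
    p.incr X r (p.index s) = X (min (p.upper s) r) - X (min (p.lower s) r) := by
  rw [incr, upper_eq hs, lower_eq hs]

theorem Partition.incr_index_self (X : ℝ≥0 → V) {s : ℝ≥0} (hs : 0 < s) :
    p.incr X s (p.index s) = X s - X (p.lower s) := by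
  rw [incr, lower_eq hs, min_eq_right (p.le_pt_index s), min_eq_left (p.pt_index_lt hs).le]

theorem Partition.tsum_incr (X : ℝ≥0 → V) (t : ℝ≥0) : ∑' i, p.incr X t i = X t - X 0 := by
  obtain ⟨N, hN⟩ := p.exists_le t
  rw [tsum_eq_sum_range (fun i hi ↦ incr_eq_zero X hi) (hN N le_rfl)]
  refine (Finset.sum_range_sub (fun i ↦ X (min (p.pt i) t)) N).trans ?_
  rw [min_eq_right (hN N le_rfl), p.pt_zero, min_eq_left zero_le]

theorem Partition.tsum_norm_incr_le {A : ℝ≥0 → V} {v : ℝ≥0 → ℝ} (hv : ControlledBy A v)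
    (t : ℝ≥0) : ∑' i, ‖p.incr A t i‖ ≤ v t - v 0 := by
  obtain ⟨N, hN⟩ := p.exists_le t
  rw [← p.tsum_incr v t, tsum_eq_sum_range (fun i hi ↦ by rw [incr_eq_zero A hi, norm_zero])
    (hN N le_rfl), tsum_eq_sum_range (fun i hi ↦ incr_eq_zero v hi) (hN N le_rfl)]
  exact Finset.sum_le_sum fun i _ ↦
    hv _ _ (min_le_min_right _ (p.strictMono (Nat.lt_succ_self i)).le)

theorem norm_incr_le {X : ℝ≥0 → V} {t : ℝ≥0} {B : ℝ} (hB : ∀ s ≤ t, ‖X s‖ ≤ B) {s : ℝ≥0}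
    (hs : s ≤ t) (i : ℕ) : ‖p.incr X s i‖ ≤ B + B :=
  (norm_sub_le _ _).trans
    (add_le_add (hB _ ((min_le_right _ _).trans hs)) (hB _ ((min_le_right _ _).trans hs)))

end Incr

/-- Constant sequences converge only to their value. -/
theorem ConvergesIn.eq_of_const {V : Type*} [NormedAddCommGroup V] [NormedSpace ℝ V] {m : Mode}
    {a l : V} (h : ConvergesIn m (fun _ ↦ a) l) : a = l := by
  cases m with
  | strong => exact tendsto_nhds_unique tendsto_const_nhds h
  | weak =>
    exact (SeparatingDual.eq_iff_forall_dual_eq (R := ℝ)).2 fun φ ↦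
      tendsto_nhds_unique tendsto_const_nhds (convergesIn_weak_iff.1 h φ)

/-! ### Stieltjes integrals of left limits -/

section Integrals

variable {V G : Type*} [NormedAddCommGroup V] [NormedSpace ℝ V] [CompleteSpace V]
  [NormedAddCommGroup G] [NormedSpace ℝ G] [CompleteSpace G]

/-- The left limits of a càdlàg operator-valued path are integrable against a càdlàg path `H` of
finite variation, and the jumps of `H` split off. -/
theorem exists_isStepLimit_isStieltjesIntegral {H : ℝ≥0 → V} {v : ℝ≥0 → ℝ}
    (hv : ControlledBy H v) (hH : IsCadlag H) {ξ g : ℝ≥0 → V →L[ℝ] G} (hξ : IsCadlag ξ) {t : ℝ≥0}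
    (hg : ∀ s ∈ Ioc 0 t, g s = leftLim ξ s) :
    ∃ I Ic : G, IsStepLimit g H v t I ∧ IsStieltjesIntegral g (contPart H) t Ic ∧
      Summable (fun s : Ioc 0 t ↦ g s (jump H s)) ∧
      I = Ic + ∑' s : Ioc 0 t, g s (jump H s) := by
  have hstep : ∀ δ > 0, ∃ h : StepFunction V G t, h.IsNormClose g δ := fun δ hδ ↦
    let ⟨h, hh, _⟩ := hξ.exists_stepFunction hg hδ
    ⟨h, hh⟩
  obtain ⟨I, hI⟩ := exists_isStepLimit hv hstep
  obtain ⟨Ic, hIc⟩ := exists_isStepLimit (hv.contPart hH) hstep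
  obtain ⟨C, hC, hb⟩ := hξ.exists_bound t
  have hgb : ∀ s ∈ Ioc 0 t, ‖g s‖ ≤ C := fun s hs ↦ by
    rw [hg s hs]
    have hsub : closure (ξ '' Iic t) ⊆ Metric.closedBall 0 C := closure_minimal (by
      rintro _ ⟨r, hr, rfl⟩
      simpa using hb r hr) Metric.isClosed_closedBall
    simpa using hsub (hξ.leftLim_mem_closure hs.1 hs.2)
  have hs : Summable ((Ioc 0 t).indicator fun u ↦ g u (jump H u)) := by
    refine Summable.of_norm_bounded ((hv.summable_norm_jump hH t).mul_left C) fun u ↦ ?_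
    by_cases hu : u ∈ Ioc 0 t
    · simp only [indicator_of_mem hu]
      exact ContinuousLinearMap.le_of_opNorm_le _ (hgb u hu) _
    · simp only [indicator_of_notMem hu, norm_zero, mul_zero, le_refl]
  refine ⟨I, Ic, hI, hIc.isStieltjesIntegral (hv.contPart hH) hstep, ?_, ?_⟩
  · exact summable_subtype_iff_indicator.2 hs
  · rw [hI.eq_add_tsum_jump hv hH (hv.contPart hH) hstep hs hIc,
      tsum_subtype (Ioc 0 t) fun u ↦ g u (jump H u)]

end Integrals

/-! ### The pair of paths -/

section Pair

variable {E F W : Type*} [NormedAddCommGroup E] [NormedAddCommGroup F]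
  {A : ℝ≥0 → F} {X : ℝ≥0 → E} {P : ℕ → Partition}

theorem continuous_toLp_one : Continuous fun q : F × E ↦ WithLp.toLp 1 q :=
  WithLp.prod_continuous_toLp 1 F E

theorem IsCadlag.pairPath (hA : IsCadlag A) (hX : IsCadlag X) : IsCadlag (pairPath A X) :=
  (hA.prodMk hX).comp continuous_toLp_one

theorem leftLim_pairPath (hA : IsCadlag A) (hX : IsCadlag X) {t : ℝ≥0} (ht : 0 < t) :
    leftLim (pairPath A X) t = WithLp.toLp 1 (leftLim A t, leftLim X t) := by
  rw [← hA.leftLim_prodMk hX ht, ← (hA.prodMk hX).leftLim_comp continuous_toLp_one ht]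
  rfl

theorem jump_pairPath (hA : IsCadlag A) (hX : IsCadlag X) {t : ℝ≥0} (ht : 0 < t) :
    jump (pairPath A X) t = WithLp.toLp 1 (jump A t, jump X t) := by
  rw [jump, leftLim_pairPath hA hX ht]
  rfl

theorem ApproximatesFromLeft.comp_pairPath [NormedAddCommGroup W] (hA : IsCadlag A)
    (hX : IsCadlag X) (hleft : ApproximatesFromLeft P (pairPath A X)) {φ : F × E → W}
    (hφ : Continuous φ) : ApproximatesFromLeft P fun s ↦ φ (A s, X s) := by
  intro t ht
  have h := hleft t ht
  rw [leftLim_pairPath hA hX ht] at h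
  rw [(hA.prodMk hX).leftLim_comp hφ ht, hA.leftLim_prodMk hX ht]
  exact (hφ.tendsto _).comp (((WithLp.prod_continuous_ofLp 1 F E).tendsto _).comp h)

/-- At a time where some function of `(A, X)` jumps, both components recover their jumps. -/
theorem ConditionC.tendsto_incr_index [NormedAddCommGroup W] (hA : IsCadlag A) (hX : IsCadlag X)
    (hC : ConditionC P (pairPath A X)) {φ : F × E → W} (hφ : Continuous φ) {s : ℝ≥0} (hs : 0 < s)
    (hj : jump (fun s ↦ φ (A s, X s)) s ≠ 0) {r : ℝ≥0} (hr : s ≤ r) :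
    Tendsto (fun n ↦ (P n).incr A r ((P n).index s)) atTop (𝓝 (jump A s)) ∧
      Tendsto (fun n ↦ (P n).incr X r ((P n).index s)) atTop (𝓝 (jump X s)) := by
  have hZ : jump (pairPath A X) s ≠ 0 := by
    intro h0
    refine hj ?_
    rw [jump_pairPath hA hX hs] at h0
    have h1 : ((jump A s, jump X s) : F × E) = 0 := (WithLp.toLp_eq_zero 1).1 h0
    have hA0 : A s = leftLim A s := sub_eq_zero.1 (congrArg Prod.fst h1)
    have hX0 : X s = leftLim X s := sub_eq_zero.1 (congrArg Prod.snd h1)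
    rw [jump, (hA.prodMk hX).leftLim_comp hφ hs, hA.leftLim_prodMk hX hs, ← hA0, ← hX0, sub_self]
  have h := hC.recovers_jumps s hZ r hr
  rw [jump_pairPath hA hX hs] at h
  have h' := ((WithLp.prod_continuous_ofLp 1 F E).tendsto _).comp h
  simp only [Partition.incr_index _ hs]
  exact ⟨(continuous_fst.tendsto _).comp h', (continuous_snd.tendsto _).comp h'⟩

theorem tendsto_incr_index_self {X : ℝ≥0 → E} (hXl : ApproximatesFromLeft P X) {s : ℝ≥0}
    (hs : 0 < s) : Tendsto (fun n ↦ (P n).incr X s ((P n).index s)) atTop (𝓝 (jump X s)) := by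
  simp only [Partition.incr_index_self _ hs]
  exact (hXl s hs).const_sub (X s)

end Pair

end ItoFollmer

theorem mainTheorem2 {E F G : Type*}
    [NormedAddCommGroup E] [NormedSpace ℝ E] [CompleteSpace E]
    [NormedAddCommGroup F] [NormedSpace ℝ F] [CompleteSpace F]
    [NormedAddCommGroup G] [NormedSpace ℝ G] [CompleteSpace G]
    (α : ReasonableCrossnorm E E) (m : Mode) (P : ℕ → Partition)
    (A : ℝ≥0 → F) (X : ℝ≥0 → E) (hA : IsCadlag A) (hX : IsCadlag X)
    (hC : ConditionC P (pairPath A X)) (hleft : ApproximatesFromLeft P (pairPath A X))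
    (Q : ℝ≥0 → α.Completed) (hQ : IsTensorQuadraticVariation m α P X Q)
    (hX2 : HasFiniteTwoVariation P X) (hAV : LocallyBoundedVariationOn A univ)
    (f : F × E → G)
    (Da : F × E → F →L[ℝ] G) (Dx : F × E → E →L[ℝ] G) (Dxx : F × E → E →L[ℝ] E →L[ℝ] G)
    (Dα : F × E → α.Completed →L[ℝ] G)
    (hDa : ∀ a x, HasGateauxDerivAt (fun b ↦ f (b, x)) (Da (a, x)) a)
    (hDa_cont : ContinuousLc Da)
    (hDx : ∀ a x, HasGateauxDerivAt (fun y ↦ f (a, y)) (Dx (a, x)) x)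
    (hDxx : ∀ a x, HasGateauxDerivAt (fun y ↦ Dx (a, y)) (Dxx (a, x)) x)
    (hDx_cont : ContinuousLc Dx)
    (hDα : ∀ p u v, Dα p (α.tmul u v) = Dxx p u v)
    (hDα_cont : ContinuousLc Dα) (t : ℝ≥0) :
    ∃ IA IX IQ S : G,
      IsStieltjesIntegral (fun s ↦ Da (Function.leftLim A s, Function.leftLim X s))
        (contPart A) t IA ∧
      IsItoFollmerIntegral m P (fun s ↦ Dx (A s, X s)) X t IX ∧
      IsStieltjesIntegral (fun s ↦ Dα (Function.leftLim A s, Function.leftLim X s))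
        (contPart Q) t IQ ∧
      HasSum (fun s : Ioc (0 : ℝ≥0) t ↦
        f (A s, X s) - f (Function.leftLim A s, Function.leftLim X s)
          - Dx (Function.leftLim A s, Function.leftLim X s) (jump X s)) S ∧
      f (A t, X t) - f (A 0, X 0) = IA + IX + (1 / 2 : ℝ) • IQ + S := by
  have cDa := hDa_cont.continuous
  have cDx := hDx_cont.continuous
  have cDα := hDα_cont.continuous
  have cf := continuous_of_hasGateauxDerivAt hDa hDx hDxx hDα cDa cDα
  have hp := hA.prodMk hX
  have hZ := hA.pairPath hX
  obtain ⟨vA, hvA⟩ := exists_controlledBy hAV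
  obtain ⟨vQ, hvQ⟩ := exists_controlledBy hQ.finiteVariation
  obtain ⟨BA, _, hBA⟩ := hA.exists_bound t
  obtain ⟨BX, hBX0, hBX⟩ := hX.exists_bound t
  obtain ⟨C, hC2⟩ := hX2 t
  replace hC2 : ∀ n, ∑' i, ‖(P n).incr X t i‖ ^ 2 ≤ C := fun n ↦ hC2 (mem_range_self n)
  have hgA : ∀ s ∈ Ioc 0 t, Da (Function.leftLim A s, Function.leftLim X s)
      = Function.leftLim (fun s ↦ Da (A s, X s)) s := fun s hs ↦ by
    rw [hp.leftLim_comp cDa hs.1, hA.leftLim_prodMk hX hs.1]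
  have hgQ : ∀ s ∈ Ioc 0 t, Dα (Function.leftLim A s, Function.leftLim X s)
      = Function.leftLim (fun s ↦ Dα (A s, X s)) s := fun s hs ↦ by
    rw [hp.leftLim_comp cDα hs.1, hA.leftLim_prodMk hX hs.1]
  obtain ⟨IA, IAc, hIA, hIAc, sA, eA⟩ :=
    exists_isStepLimit_isStieltjesIntegral hvA hA (hp.comp cDa) hgA
  obtain ⟨IQ, IQc, hIQ, hIQc, sQ, eQ⟩ :=
    exists_isStepLimit_isStieltjesIntegral hvQ hQ.cadlag (hp.comp cDα) hgQ
  have hAl : ApproximatesFromLeft P A := hleft.comp_pairPath hA hX continuous_fst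
  have hXl : ApproximatesFromLeft P X := hleft.comp_pairPath hA hX continuous_snd
  have limA : ConvergesIn m (fun n ↦ ∑' i, Da (A ((P n).pt i), X ((P n).pt i))
      ((P n).incr A t i)) IA :=
    convergesIn_riemannSum (ξ := fun s ↦ Da (A s, X s)) (q := fun n i s ↦ (P n).incr A s i)
      hvA hA (hp.comp cDa) (hleft.comp_pairPath hA hX cDa)
      (fun n i s hs ↦ Partition.incr_eq_zero A hs) (fun n i s hs ↦ Partition.incr_eq_of_le A hs)
      (fun n ↦ Partition.tsum_norm_incr_le hvA t) (fun n i s hs ↦ norm_incr_le hBA hs i)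
      (fun s hs ↦ tendsto_incr_index_self hAl hs.1)
      (fun s hs hj r hr ↦ (hC.tendsto_incr_index hA hX cDa hs.1 hj hr.1).1)
      (fun s _ ↦ by
        simp only [Partition.tsum_incr]; exact ConvergesIn.of_tendsto tendsto_const_nhds)
      hgA hIA
  -- the sums that define `Q 0` vanish
  have hQ0 : Q 0 = 0 := by
    have h := hQ.converges 0
    simp only [Partition.incr_eq_zero X (zero_le : 0 ≤ (P _).pt _), map_zero, tsum_zero] at h
    exact h.eq_of_const.symm
  have limQ : ConvergesIn m (fun n ↦ ∑' i, Dα (A ((P n).pt i), X ((P n).pt i))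
      (α.tmul ((P n).incr X t i) ((P n).incr X t i))) IQ := by
    have ct : Continuous fun x : E ↦ α.tmul x x := by fun_prop
    refine convergesIn_riemannSum (ξ := fun s ↦ Dα (A s, X s))
      (q := fun n i s ↦ α.tmul ((P n).incr X s i) ((P n).incr X s i)) (C := C)
      (C' := (BX + BX) * (BX + BX))
      hvQ hQ.cadlag (hp.comp cDα) (hleft.comp_pairPath hA hX cDα) ?_ ?_ ?_ ?_ ?_ ?_ ?_ hgQ hIQ
    · intro n i s hs
      rw [Partition.incr_eq_zero X hs, map_zero]
    · intro n i s hs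
      rw [Partition.incr_eq_of_le X hs]
    · intro n
      simp only [α.norm_tmul, ← sq]
      exact hC2 n
    · intro n i s hs
      rw [α.norm_tmul]
      have := norm_incr_le (p := P n) hBX hs i
      gcongr
    · intro s hs
      rw [hQ.jump_eq]
      exact (ct.tendsto _).comp (tendsto_incr_index_self hXl hs.1)
    · intro s hs hj r hr
      rw [hQ.jump_eq]
      exact (ct.tendsto _).comp (hC.tendsto_incr_index hA hX cDα hs.1 hj hr.1).2
    · intro s _
      rw [hQ0, sub_zero]
      exact hQ.converges s
  -- the Taylor remainders over the intervals converge to the Taylor remainders at the jumps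
  have hcj : Summable fun s : Ioc (0 : ℝ≥0) t ↦
      ‖(jump (pairPath A X) s).fst‖ + ‖(jump (pairPath A X) s).snd‖ ^ 2 := by
    have h1 := summable_subtype_iff_indicator.2 (hvA.summable_norm_jump hA t)
    have h2 := summable_subtype_iff_indicator.2 (hvQ.summable_norm_jump hQ.cadlag t)
    refine (h1.add h2).congr fun s ↦ ?_
    rw [jump_pairPath hA hX s.2.1]
    simp only [Function.comp_apply, hQ.jump_eq, α.norm_tmul, sq]
    rfl
  have hcsum : ∀ n, ∑' i, (‖((P n).incr (pairPath A X) t i).fst‖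
      + ‖((P n).incr (pairPath A X) t i).snd‖ ^ 2) ≤ (vA t - vA 0) + C := by
    intro n
    obtain ⟨N, hN⟩ := (P n).exists_le t
    have h1 := Partition.tsum_norm_incr_le (p := P n) hvA t
    have h2 := hC2 n
    rw [Partition.tsum_eq_sum_range (p := P n) (t := t) (fun i hi ↦ by
      rw [Partition.incr_eq_zero _ hi]; simp) (hN N le_rfl)] at h1 h2 ⊢
    rw [Finset.sum_add_distrib]
    exact add_le_add h1 h2
  have hofLp : Continuous fun z : WithLp 1 (F × E) ↦ WithLp.ofLp z :=
    WithLp.prod_continuous_ofLp 1 F E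
  obtain ⟨sR, limR⟩ := tendsto_tsum_remainder (P := P) hZ hC hleft t
    (r := fun z z' ↦ taylorRem α f Da Dx Dα (WithLp.ofLp z) (WithLp.ofLp z'))
    (c := fun z ↦ ‖z.fst‖ + ‖z.snd‖ ^ 2)
    ((continuous_taylorRem cf cDa cDx cDα).comp
      ((hofLp.comp continuous_fst).prodMk (hofLp.comp continuous_snd)))
    (fun z ↦ by simp [taylorRem]) (fun z ↦ by positivity) (by simp)
    (fun K hK η hη ↦ by
      obtain ⟨δ, hδ, hd⟩ := exists_norm_taylorRem_le hDa hDx hDxx hDα cDa cDα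
        (hK.image hofLp) hη
      refine ⟨δ, hδ, fun x hx y hy ↦ hd _ (mem_image_of_mem _ hx) _ (lt_of_le_of_lt ?_ hy)⟩
      rw [WithLp.prod_norm_eq_of_L1]
      exact max_le (le_add_of_nonneg_right (norm_nonneg _))
        (le_add_of_nonneg_left (norm_nonneg _)))
    hcsum hcj
  set R : G := ∑' s : Ioc (0 : ℝ≥0) t, taylorRem α f Da Dx Dα
    (WithLp.ofLp (Function.leftLim (pairPath A X) s)) (WithLp.ofLp (pairPath A X s)) with hR
  set SA : G := ∑' s : Ioc (0 : ℝ≥0) t,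
    Da (Function.leftLim A s, Function.leftLim X s) (jump A s) with hSA
  set SQ : G := ∑' s : Ioc (0 : ℝ≥0) t,
    Dα (Function.leftLim A s, Function.leftLim X s) (jump Q s) with hSQ
  refine ⟨IAc, f (A t, X t) - f (A 0, X 0) - IA - (1 / 2 : ℝ) • IQ - R, IQc,
    R + SA + (1 / 2 : ℝ) • SQ, hIAc, ?_, hIQc, ?_, ?_⟩
  · -- the Riemann sums are the increment of `f` minus the other three sums of its expansion
    have h := (((ConvergesIn.of_tendsto (m := m) (tendsto_const_nhds
      (x := f (A t, X t) - f (A 0, X 0)))).sub limA).sub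
      (limQ.map ((1 / 2 : ℝ) • ContinuousLinearMap.id ℝ G))).sub
      (ConvergesIn.of_tendsto (m := m) limR)
    refine Eq.mp ?_ h
    rw [IsItoFollmerIntegral]
    congr 1
    funext n
    obtain ⟨N, hN⟩ := (P n).exists_le t
    have hN := hN N le_rfl
    rw [Partition.tsum_eq_sum_range (p := P n) (t := t) (fun i hi ↦ by
        rw [Partition.incr_eq_zero _ hi, map_zero]) hN,
      Partition.tsum_eq_sum_range (p := P n) (t := t) (fun i hi ↦ by
        rw [Partition.incr_eq_zero _ hi, map_zero, map_zero]) hN,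
      Partition.tsum_eq_sum_range (p := P n) (t := t) (fun i hi ↦ by
        have hi' : t ≤ (P n).pt (i + 1) := hi.trans ((P n).strictMono (Nat.lt_succ_self i)).le
        simp [min_eq_right hi, min_eq_right hi', taylorRem]) hN,
      Partition.tsum_eq_sum_range (p := P n) (t := t) (fun i hi ↦ by
        rw [Partition.incr_eq_zero _ hi, map_zero]) hN,
      ← (P n).tsum_incr (fun s ↦ f (A s, X s)) t,
      Partition.tsum_eq_sum_range (p := P n) (t := t) (fun i hi ↦ by
        rw [Partition.incr_eq_zero _ hi]) hN, map_sum, ← Finset.sum_sub_distrib,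
      ← Finset.sum_sub_distrib, ← Finset.sum_sub_distrib]
    refine Finset.sum_congr rfl fun i _ ↦ ?_
    rcases le_or_gt t ((P n).pt i) with hi | hi
    · have hi' : t ≤ (P n).pt (i + 1) := hi.trans ((P n).strictMono (Nat.lt_succ_self i)).le
      simp only [Partition.incr_eq_zero _ hi, map_zero, min_eq_right hi, min_eq_right hi']
      simp [taylorRem]
    · simp only [taylorRem, Partition.incr, pairPath, min_eq_left hi.le, smul_apply,
        ContinuousLinearMap.id_apply]
      abel
  · have h := (sR.hasSum.add sA.hasSum).add (sQ.hasSum.const_smul (1 / 2 : ℝ))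
    convert h using 2 with s
    rw [leftLim_pairPath hA hX s.2.1, hQ.jump_eq]
    simp only [taylorRem, pairPath, jump]
    abel
  · rw [eA, eQ, smul_add]
    abel
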